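/- Let $n\ge 1$ and let $G=Sp_{2n}(\mathbb C)$ be the simply connected simple algebraic group of type $C_n$, with Cartan matrix $a_{i,j}=\alpha_j(h_i)$ given by $a_{i,i}=2$, $a_{n-1,n}=-2$, $a_{i,j}=-1$ for the other pairs with $|i-j|=1$, and $a_{i,j}=0$ otherwise. The Chevalley generators act on the vector representation with basis $v_1,\dots,v_n,v_{\bar n},\dots,v_{\bar 1}$ by $f_iv_i=v_{i+1}$, $f_iv_{\overline{i+1}}=v_{\bar i}$, $e_iv_{i+1}=v_i$, $e_iv_{\bar i}=v_{\overline{i+1}}$ $(1\le i<n)$, $f_nv_n=v_{\bar n}$, $e_nv_{\bar n}=v_n$, and by zero on the other basis vectors. Let $T$ be the diagonal maximal torus and $U^{+}$, $U^-$ the upper and lower unitriangular subgroups of $G$ with respect to the above ordered basis. Let $\Lambda_1,\dots,\Lambda_n$ be the fundamental weights, $s_1,\dots,s_n$ the simple reflections, $W$ the Weyl group, and $w_0\in W$ its longest element. Put $x_i(a)=\exp(ae_i)$, $y_i(a)=\exp(af_i)$, $\overline{s}_i=x_i(-1)y_i(1)x_i(-1)$, and $\overline w=\overline s_{i_1}\cdots\overline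 s_{i_l}$ for a reduced expression $w=s_{i_1}\cdots s_{i_l}$. For a dominant weight $\mu$ let $\Delta_\mu$ be the regular function on $G$ with $\Delta_\mu(u^-tu^+)=\mu(t)$ for $u^\pm\in U^\pm$, $t\in T$, and for $u,v\in W$ put $\Delta_{u\mu,v\mu}(g)=\Delta_\mu(\overline u^{-1}g\,\overline v)$. For $c=(c^{(j)}_i)_{1\le i,j\le n}\in(\mathbb C^\times)^{n^2}$ set $\mathbf y_i(a)=y_i(a)\alpha_i^\vee(a^{-1})$ and, for the reduced word $\mathbf i_0=(1,2,\dots,n)^n$ of $w_0$, $$\Theta^-_{\mathbf i_0}(c)=\prod_{j=1}^{n}\mathbf y_1(c^{(j)}_1)\,\mathbf y_2(c^{(j)}_2)\cdots\mathbf y_n(c^{(j)}_n),$$ the factors being taken in the order $j=1,2,\dots,n$ from left to right. Put $c^{(j)}_0=1$. Then: (i) For every $k\in\{1,\dots,n-1\}$, $$\Delta_{w_0s_k\Lambda_k,\Lambda_k}(\Theta^-_{\mathbf i_0}(c))=\frac1{c^{(k)}_1}+\sum_{j=1}^{k-1}\frac{c^{(j)}_{k-j}}{c^{(j)}_{k-j+1}}.$$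 (ii) With $C^{(j)}_i=\dfrac{c^{(n-j)}_i}{c^{(n-j+1)}_{i-1}}$ and $\overline C^{(j)}_i=\dfrac{c^{(n-j)}_{i-1}}{c^{(n-j)}_i}$, $$\Delta_{w_0s_n\Lambda_n,\Lambda_n}(\Theta^-_{\mathbf i_0}(c))=\sum C^{(1)}_{u_1}C^{(2)}_{u_2}\cdots C^{(m)}_{u_m}\cdot\overline C^{(l_1-1)}_{l_1}\,\overline C^{(l_2-2)}_{l_2}\cdots\overline C^{(l_k-k)}_{l_k},$$ where the sum is over all $m,k$ with $k+m=n$, $0\le m<n$, and all sequences of integers $1\le u_1<\cdots<u_m\le n$ and $1\le l_1<\cdots<l_k\le n$. -/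

import Mathlib

open scoped Matrix

noncomputable section

namespace TypeC

/-! ### Root datum of type `C_n`

The nodes `1, …, n` of the Dynkin diagram are the elements `0, …, n - 1` of `Fin n`. -/

/-- The node with (one-based) number `k`. -/
def node (n k : ℕ) (h1 : 1 ≤ k) (hn : k ≤ n) : Fin n := ⟨k - 1, by omega⟩

/-- The Cartan matrix `(a_{i,j})` of type `C_n`, with `a_{i,j} = α_j(h_i)`; the simple root with the
last index is the long one. -/
def cartan (n : ℕ) : Matrix (Fin n) (Fin n) ℤ := Matrix.of fun i j =>
  if i = j then 2
  else if (i : ℕ) + 1 = j ∧ (j : ℕ) + 1 = n then -2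
  else if (i : ℕ) + 1 = j ∨ (j : ℕ) + 1 = i then -1
  else 0

/-- The weight lattice `P`. A weight `λ` is given by its coordinates `⟨h_i, λ⟩` with respect to the
fundamental weights. -/
abbrev Weight (n : ℕ) : Type := Fin n → ℤ

/-- The fundamental weight `Λ_i`. -/
def fundWeight {n : ℕ} (i : Fin n) : Weight n := Pi.single i 1

/-- The simple root `α_i`, so that `⟨h_j, α_i⟩ = a_{j,i}`. -/
def simpleRoot {n : ℕ} (i : Fin n) : Weight n := fun j => cartan n j i

theorem proj_simpleRoot {n : ℕ} (i : Fin n) :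
    (LinearMap.proj i : Weight n →ₗ[ℤ] ℤ) (simpleRoot i) = 2 := by
  simp [simpleRoot, cartan]

/-- The simple reflection `λ ↦ λ - ⟨h_i, λ⟩ α_i` of the weight lattice. -/
def reflection {n : ℕ} (i : Fin n) : Weight n ≃ₗ[ℤ] Weight n :=
  Module.reflection (proj_simpleRoot i)

/-- The Weyl group, generated by the simple reflections. -/
def weylGroup (n : ℕ) : Subgroup (Weight n ≃ₗ[ℤ] Weight n) :=
  Subgroup.closure (Set.range reflection)

/-- The simple reflection `s_i` as an element of the Weyl group. -/
def s {n : ℕ} (i : Fin n) : weylGroup n :=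
  ⟨reflection i, Subgroup.subset_closure (Set.mem_range_self i)⟩

/-- `s_{i_1} ⋯ s_{i_l}` is a reduced expression of `w`. -/
def IsReducedWord {n : ℕ} (l : List (Fin n)) (w : weylGroup n) : Prop :=
  (l.map s).prod = w ∧ ∀ l' : List (Fin n), (l'.map s).prod = w → l.length ≤ l'.length

/-- `w` is an element of maximal length of the Weyl group. -/
def IsLongest {n : ℕ} (w : weylGroup n) : Prop :=
  ∃ l, IsReducedWord l w ∧ ∀ (w' : weylGroup n) l', IsReducedWord l' w' → l'.length ≤ l.length

/-- The longest element `w_0` of the Weyl group. -/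
def w₀ (n : ℕ) : weylGroup n := Classical.epsilon IsLongest

/-! ### The vector representation and the group `Sp_{2n}(ℂ)` -/

/-- Indices of the basis of the vector representation: `Sum.inl i` stands for `v_i` and `Sum.inr i`
for `v_{ī}`. -/
abbrev J (n : ℕ) : Type := Fin n ⊕ Fin n

/-- Position in the order `1 < ⋯ < n < n̄ < ⋯ < 1̄`. -/
def rank {n : ℕ} : J n → ℕ
  | Sum.inl i => i
  | Sum.inr i => 2 * n - 1 - i

/-- The weights of the basis vectors: `wt v_i = Λ_i - Λ_{i-1}` and `wt v_{ī} = Λ_{i-1} - Λ_i`,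
where `Λ_0 = 0`. -/
def wt {n : ℕ} : J n → Weight n
  | Sum.inl i => fun k => if k = i then 1 else if (k : ℕ) + 1 = i then -1 else 0
  | Sum.inr i => fun k => if k = i then -1 else if (k : ℕ) + 1 = i then 1 else 0

/-- The Chevalley generator `e_i` on the vector representation:
`e_i v_{i+1} = v_i` and `e_i v_{ī} = v_{\overline{i+1}}` for `i < n`, `e_n v_{n̄} = v_n`, and all the
other basis vectors are sent to `0`. -/
def e {n : ℕ} (i : Fin n) : Matrix (J n) (J n) ℂ := Matrix.of fun r t =>
  match r, t with
  | Sum.inl a, Sum.inl b => if a = i ∧ (b : ℕ) = i + 1 then 1 else 0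
  | Sum.inr a, Sum.inr b => if b = i ∧ (a : ℕ) = i + 1 then 1 else 0
  | Sum.inl a, Sum.inr b => if a = i ∧ b = i ∧ (i : ℕ) + 1 = n then 1 else 0
  | Sum.inr _, Sum.inl _ => 0

/-- The Chevalley generator `f_i` on the vector representation:
`f_i v_i = v_{i+1}` and `f_i v_{\overline{i+1}} = v_{ī}` for `i < n`, `f_n v_n = v_{n̄}`, and all the
other basis vectors are sent to `0`. -/
def f {n : ℕ} (i : Fin n) : Matrix (J n) (J n) ℂ := (e i)ᵀ

/-- The Gram matrix of the symplectic form that the `e_i` and `f_i` leave invariant: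
`ω(v_i, v_{ī}) = (-1)^(i-1) = -ω(v_{ī}, v_i)`. -/
def Ω (n : ℕ) : Matrix (J n) (J n) ℂ := Matrix.of fun r t =>
  match r, t with
  | Sum.inl a, Sum.inr b => if a = b then (-1) ^ (a : ℕ) else 0
  | Sum.inr a, Sum.inl b => if a = b then -(-1) ^ (a : ℕ) else 0
  | Sum.inl _, Sum.inl _ => 0
  | Sum.inr _, Sum.inr _ => 0

/-- The simply connected simple algebraic group of type `C_n`, that is, the symplectic group
`Sp_{2n}(ℂ)` of the form with Gram matrix `Ω`. -/
def G (n : ℕ) : Subgroup (GL (J n) ℂ) where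
  carrier := {g | (g : Matrix (J n) (J n) ℂ)ᵀ * Ω n * (g : Matrix (J n) (J n) ℂ) = Ω n}
  one_mem' := by simp
  mul_mem' := by
    intro a b ha hb
    simp only [Set.mem_ofPred_eq, Units.val_mul, Matrix.transpose_mul] at *
    calc _ = (b : Matrix (J n) (J n) ℂ)ᵀ *
          ((a : Matrix (J n) (J n) ℂ)ᵀ * Ω n * (a : Matrix (J n) (J n) ℂ)) *
          (b : Matrix (J n) (J n) ℂ) := by simp only [Matrix.mul_assoc]
      _ = _ := by rw [ha, hb]
  inv_mem' := by
    intro a ha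
    simp only [Set.mem_ofPred_eq] at *
    have h1 : (a : Matrix (J n) (J n) ℂ) * ((a⁻¹ : GL (J n) ℂ) : Matrix (J n) (J n) ℂ) = 1 := by
      rw [← Units.val_mul, mul_inv_cancel, Units.val_one]
    have h2 : ((a⁻¹ : GL (J n) ℂ) : Matrix (J n) (J n) ℂ)ᵀ * (a : Matrix (J n) (J n) ℂ)ᵀ = 1 := by
      rw [← Matrix.transpose_mul, h1, Matrix.transpose_one]
    calc _ = ((a⁻¹ : GL (J n) ℂ) : Matrix (J n) (J n) ℂ)ᵀ *
          ((a : Matrix (J n) (J n) ℂ)ᵀ * Ω n * (a : Matrix (J n) (J n) ℂ)) *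
          ((a⁻¹ : GL (J n) ℂ) : Matrix (J n) (J n) ℂ) := by rw [ha]
      _ = (((a⁻¹ : GL (J n) ℂ) : Matrix (J n) (J n) ℂ)ᵀ * (a : Matrix (J n) (J n) ℂ)ᵀ) * Ω n *
          ((a : Matrix (J n) (J n) ℂ) * ((a⁻¹ : GL (J n) ℂ) : Matrix (J n) (J n) ℂ)) := by
            simp only [Matrix.mul_assoc]
      _ = _ := by rw [h1, h2, one_mul, mul_one]

/-- The matrix of an element of the group. -/
def mat {n : ℕ} (g : G n) : Matrix (J n) (J n) ℂ := ((g : GL (J n) ℂ) : Matrix (J n) (J n) ℂ)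

theorem exp_of_sq_eq_zero {n : ℕ} (A : Matrix (J n) (J n) ℂ) (h : A * A = 0) :
    NormedSpace.exp A = 1 + A := by
  rw [NormedSpace.exp_eq_tsum ℚ]
  have hz : ∀ k ∉ Finset.range 2, ((k.factorial : ℚ)⁻¹) • A ^ k = 0 := by
    intro k hk
    obtain ⟨m, rfl⟩ : ∃ m, k = m + 2 := ⟨k - 2, by simp at hk; omega⟩
    rw [pow_add, pow_two, h, mul_zero, smul_zero]
  show ∑' k : ℕ, ((k.factorial : ℚ)⁻¹) • A ^ k = _
  rw [tsum_eq_sum hz]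
  simp [Finset.sum_range_succ]

/-- The exponential of an element of the symplectic Lie algebra of square zero. -/
def expUnit {n : ℕ} (A : Matrix (J n) (J n) ℂ) (h : A * A = 0)
    (hA : Aᵀ * Ω n + Ω n * A = 0) : G n :=
  ⟨⟨NormedSpace.exp A, NormedSpace.exp (-A), by
      rw [exp_of_sq_eq_zero A h, exp_of_sq_eq_zero (-A) (by simp [h])]
      simp [mul_add, add_mul, h], by
      rw [exp_of_sq_eq_zero A h, exp_of_sq_eq_zero (-A) (by simp [h])]
      simp [mul_add, add_mul, h]⟩, by
    show (NormedSpace.exp A)ᵀ * Ω n * NormedSpace.exp A = Ω n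
    rw [exp_of_sq_eq_zero A h]
    have h2 : Aᵀ * Ω n = -(Ω n * A) := eq_neg_of_add_eq_zero_left hA
    simp [mul_add, add_mul, h2, Matrix.mul_assoc, h]⟩

theorem e_mul_e {n : ℕ} (i : Fin n) : e i * e i = 0 := by
  ext r t
  rw [Matrix.mul_apply]
  refine Finset.sum_eq_zero fun x _ => ?_
  rcases r with a | a <;> rcases t with b | b <;> rcases x with x | x <;>
    simp only [e, Matrix.of_apply] <;> grind

theorem Ω_mul_inl {n : ℕ} (M : Matrix (J n) (J n) ℂ) (a : Fin n) (t : J n) :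
    (Ω n * M) (Sum.inl a) t = (-1) ^ (a : ℕ) * M (Sum.inr a) t := by
  simp [Ω, Matrix.mul_apply, Fintype.sum_sum_type]

theorem Ω_mul_inr {n : ℕ} (M : Matrix (J n) (J n) ℂ) (a : Fin n) (t : J n) :
    (Ω n * M) (Sum.inr a) t = -(-1) ^ (a : ℕ) * M (Sum.inl a) t := by
  simp [Ω, Matrix.mul_apply, Fintype.sum_sum_type]

theorem mul_Ω_inl {n : ℕ} (M : Matrix (J n) (J n) ℂ) (r : J n) (b : Fin n) :
    (M * Ω n) r (Sum.inl b) = -(-1) ^ (b : ℕ) * M r (Sum.inr b) := by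
  simp [Ω, Matrix.mul_apply, Fintype.sum_sum_type, mul_comm]

theorem mul_Ω_inr {n : ℕ} (M : Matrix (J n) (J n) ℂ) (r : J n) (b : Fin n) :
    (M * Ω n) r (Sum.inr b) = (-1) ^ (b : ℕ) * M r (Sum.inl b) := by
  simp [Ω, Matrix.mul_apply, Fintype.sum_sum_type, mul_comm]

theorem e_mem {n : ℕ} (i : Fin n) : (e i)ᵀ * Ω n + Ω n * e i = 0 := by
  ext r t
  rcases r with a | a <;> rcases t with b | b <;>
    simp only [Matrix.add_apply, Ω_mul_inl, Ω_mul_inr, mul_Ω_inl, mul_Ω_inr, e,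
      Matrix.transpose_apply, Matrix.of_apply, Matrix.zero_apply] <;> grind

theorem f_mul_f {n : ℕ} (i : Fin n) : f i * f i = 0 := by
  rw [f, ← Matrix.transpose_mul, e_mul_e, Matrix.transpose_zero]

theorem f_mem {n : ℕ} (i : Fin n) : (f i)ᵀ * Ω n + Ω n * f i = 0 := by
  ext r t
  rcases r with a | a <;> rcases t with b | b <;>
    simp only [Matrix.add_apply, Ω_mul_inl, Ω_mul_inr, mul_Ω_inl, mul_Ω_inr, e, f,
      Matrix.transpose_apply, Matrix.of_apply, Matrix.zero_apply] <;> grind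

/-- `x_i(a) = exp (a e_i)`. -/
def x {n : ℕ} (i : Fin n) (a : ℂ) : G n :=
  expUnit (a • e i) (by simp [e_mul_e]) (by
    rw [Matrix.transpose_smul, Matrix.smul_mul, Matrix.mul_smul, ← smul_add, e_mem, smul_zero])

/-- `y_i(a) = exp (a f_i)`. -/
def y {n : ℕ} (i : Fin n) (a : ℂ) : G n :=
  expUnit (a • f i) (by simp [f_mul_f]) (by
    rw [Matrix.transpose_smul, Matrix.smul_mul, Matrix.mul_smul, ← smul_add, f_mem, smul_zero])

/-- The value of the weight `λ`, regarded as a character of the maximal torus, at the element with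
coordinates `a`, that is, at `α_1^∨(a_1) ⋯ α_n^∨(a_n)`. -/
def character {n : ℕ} (lam : Weight n) (a : Fin n → ℂˣ) : ℂˣ := ∏ i, a i ^ lam i

theorem character_wt_inl_mul_inr {n : ℕ} (i : Fin n) (a : Fin n → ℂˣ) :
    character (wt (Sum.inl i)) a * character (wt (Sum.inr i)) a = 1 := by
  rw [character, character, ← Finset.prod_mul_distrib]
  refine Finset.prod_eq_one fun k _ => ?_
  rw [← zpow_add]
  simp only [wt]
  split_ifs <;> simp

/-- The element `α_1^∨(a_1) ⋯ α_n^∨(a_n)` of the maximal torus `T`: it multiplies each basis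
vector `v` by the value of the character `wt v`. All elements of `T` are of this form, for unique
`a_1, …, a_n`, since the group is simply connected. -/
def torus {n : ℕ} (a : Fin n → ℂˣ) : G n :=
  ⟨⟨Matrix.diagonal fun j => (character (wt j) a : ℂ),
      Matrix.diagonal fun j => ((character (wt j) a)⁻¹ : ℂˣ), by
        rw [Matrix.diagonal_mul_diagonal, ← Matrix.diagonal_one]; simp, by
        rw [Matrix.diagonal_mul_diagonal, ← Matrix.diagonal_one]; simp⟩, by
    show (Matrix.diagonal fun j => (character (wt j) a : ℂ))ᵀ * Ω n *
      (Matrix.diagonal fun j => (character (wt j) a : ℂ)) = Ω n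
    ext r t
    rw [Matrix.diagonal_transpose, Matrix.mul_diagonal, Matrix.diagonal_mul]
    have h (i : Fin n) : (character (wt (Sum.inl i)) a : ℂ) * character (wt (Sum.inr i)) a = 1 := by
      rw [← Units.val_mul, character_wt_inl_mul_inr, Units.val_one]
    rcases r with i | i <;> rcases t with k | k <;> simp only [Ω, Matrix.of_apply] <;> grind⟩

/-- The coroot `α_i^∨ : ℂˣ → T`. -/
def coroot {n : ℕ} (i : Fin n) (a : ℂˣ) : G n := torus (Pi.mulSingle i a)

/-- The maximal unipotent subgroup `U`: the upper unitriangular elements of the group, for the order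
`1 < ⋯ < n < n̄ < ⋯ < 1̄` of the basis. -/
def IsUpperUnipotent {n : ℕ} (g : G n) : Prop :=
  (∀ r, mat g r r = 1) ∧ ∀ r t, rank t < rank r → mat g r t = 0

/-- The maximal unipotent subgroup `U⁻`: the lower unitriangular elements of the group. -/
def IsLowerUnipotent {n : ℕ} (g : G n) : Prop :=
  (∀ r, mat g r r = 1) ∧ ∀ r t, rank r < rank t → mat g r t = 0

/-- The representative `x_i(-1) y_i(1) x_i(-1)` of `s_i`. -/
def sBar {n : ℕ} (i : Fin n) : G n := x i (-1) * y i 1 * x i (-1)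

/-- The representative of `w` in the group: the product of the representatives of the simple
reflections along a reduced expression of `w`. It does not depend on this expression. -/
def weylRep {n : ℕ} (w : weylGroup n) : G n :=
  ((Classical.epsilon fun l : List (Fin n) => IsReducedWord l w).map sBar).prod

/-! ### Generalized minors -/

/-- Regular functions on the group, a closed subvariety of the affine space of matrices. -/
def IsRegular {n : ℕ} (F : G n → ℂ) : Prop :=
  ∃ p : MvPolynomial (J n × J n) ℂ, ∀ g, F g = MvPolynomial.eval (fun q => mat g q.1 q.2) p

/-- `F` is the regular function on the group with `F (u⁻ t u⁺) = μ(t)` for all `u⁻ ∈ U⁻`, `t ∈ T`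
and `u⁺ ∈ U`. -/
def IsPrincipalMinor {n : ℕ} (mu : Weight n) (F : G n → ℂ) : Prop :=
  IsRegular F ∧ ∀ (u v : G n) (a : Fin n → ℂˣ), IsLowerUnipotent u → IsUpperUnipotent v →
    F (u * torus a * v) = character mu a

/-- The principal minor `Δ_μ`. -/
def principalMinor {n : ℕ} (mu : Weight n) : G n → ℂ := Classical.epsilon (IsPrincipalMinor mu)

/-- The generalized minor `Δ_{γ,δ}` for `γ`, `δ` in the orbit of the dominant weight `μ`: it is
`g ↦ Δ_μ(ū⁻¹ g v̄)` for Weyl group elements with `γ = u μ` and `δ = v μ`. -/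
def generalizedMinor {n : ℕ} (mu gam del : Weight n) (g : G n) : ℂ :=
  let u : weylGroup n := Classical.epsilon fun w => (w : Weight n ≃ₗ[ℤ] Weight n) mu = gam
  let v : weylGroup n := Classical.epsilon fun w => (w : Weight n ≃ₗ[ℤ] Weight n) mu = del
  principalMinor mu ((weylRep u)⁻¹ * g * weylRep v)

/-! ### The parametrization and the monomials -/

/-- `𝐲_i(a) = y_i(a) α_i^∨(a⁻¹)`. -/
def bigY {n : ℕ} (i : Fin n) (a : ℂˣ) : G n := y i a * coroot i a⁻¹

/-- `Θ⁻(c)` for the reduced word `(1, 2, …, n)^n` of `w_0`: the product of the factors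
`𝐲_1(c_1^{(j)}) 𝐲_2(c_2^{(j)}) ⋯ 𝐲_n(c_n^{(j)})` over `j = 1, …, n`, in this order. Here `c i j` is
the variable with lower index `i + 1` and upper index `j + 1`. -/
def Θ {n : ℕ} (c : Fin n → Fin n → ℂˣ) : G n :=
  (List.ofFn fun j => (List.ofFn fun i => bigY i (c i j)).prod).prod

/-- `c_i^{(j)}` with the one-based indices `1 ≤ i, j ≤ n`, and `c_0^{(j)} = 1`. -/
def coord {n : ℕ} (c : Fin n → Fin n → ℂˣ) (i j : ℕ) : ℂ :=
  if h : (1 ≤ i ∧ i ≤ n) ∧ (1 ≤ j ∧ j ≤ n) then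
    (c (node n i h.1.1 h.1.2) (node n j h.2.1 h.2.2) : ℂ)
  else 1

/-- `C_i^{(j)} = c_i^{(n-j)} / c_{i-1}^{(n-j+1)}`. -/
def monC {n : ℕ} (c : Fin n → Fin n → ℂˣ) (i j : ℕ) : ℂ :=
  coord c i (n - j) / coord c (i - 1) (n - j + 1)

/-- `C̄_i^{(j)} = c_{i-1}^{(n-j)} / c_i^{(n-j)}`. -/
def monCbar {n : ℕ} (c : Fin n → Fin n → ℂˣ) (i j : ℕ) : ℂ :=
  coord c (i - 1) (n - j) / coord c i (n - j)

open Classical in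
/-- The sequences `1 ≤ u_1 < u_2 < ⋯ < u_m ≤ n` of integers. -/
def increasing (n m : ℕ) : Finset (Fin m → ℕ) :=
  (Fintype.piFinset fun _ => Finset.Icc 1 n).filter StrictMono

end TypeC

end

/-!
All but finitely many points of a polynomial curve in the group which starts in `T` lie in the big
cell `U⁻ T U⁺`, so two regular functions that agree on the big cell agree at its endpoint. As the
products of the `x_i(a)`, `y_i(a)` and elements of `T` are such endpoints, `Δ_{Λ_k}` is given there
by the leading `k × k` minor in the vector representation. The representative of a reduced word
permutes the basis up to signs which count inversions, so `Δ_{uΛ_k, vΛ_k}` is the minor with the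
permuted rows and columns, signed by their inversions. For `u = w₀ s_k` and `v = 1` the rows are
`1̄, …, \overline{k-1}` and `\overline{k+1}`, or `n` when `k = n`.

The lower left block of `Θ⁻(c)` is the product of the matrix `blockCol` with the matrix of the
`n`-th rows of the partial products of `Θ⁻(c)`, which is upper unitriangular. Column operations
recorded by `upEntry` turn `blockCol` into the lower unitriangular `lowEntry`, so that the minor
reduces to its last diagonal entry. For `k = n` the last row is the `n`-th row of `Θ⁻(c)` itself;
it is expanded in the same partial products, with sums over increasing sequences as coefficients.
-/

open scoped Matrix

noncomputable section

namespace TypeC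

variable {n : ℕ}

section Matrices

open Matrix OrderDual

variable {α m R : Type*} [LinearOrder α] {b : m → α} [CommRing R]

theorem blockTriangular_mul_apply_self [Fintype m] {A B : Matrix m m R} (hb : b.Injective)
    (hA : A.BlockTriangular b) (hB : B.BlockTriangular b) (r : m) :
    (A * B) r r = A r r * B r r := by
  rw [Matrix.mul_apply, Fintype.sum_eq_single r]
  intro t htr
  rcases lt_or_gt_of_ne (hb.ne htr) with h | h
  · rw [hA h, zero_mul]
  · rw [hB h, mul_zero]

variable [DecidableEq m]

theorem det_of_blockTriangular_of_injective [Fintype m] {M : Matrix m m R} (hb : b.Injective)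
    (hM : M.BlockTriangular b) : M.det = ∏ r, M r r := by
  let _ : LinearOrder m := LinearOrder.lift' b hb
  convert Matrix.det_of_isUpperTriangular (M := M) fun r t h => hM h

theorem eq_one_of_blockTriangular {M : Matrix m m R} (hb : b.Injective)
    (hupper : M.BlockTriangular b) (hlower : M.BlockTriangular (toDual ∘ b))
    (hdiag : ∀ r, M r r = 1) : M = 1 := by
  ext r t
  rcases lt_trichotomy (b r) (b t) with h | h | h
  · rw [hlower (toDual_lt_toDual.mpr h), Matrix.one_apply_ne (ne_of_apply_ne b h.ne)]
  · rw [hb h, hdiag, Matrix.one_apply_eq]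
  · rw [hupper h, Matrix.one_apply_ne (ne_of_apply_ne b h.ne')]

theorem exists_row_combination [Fintype m] (M : Matrix m m R) (r : m)
    (hM : IsUnit (M.toSquareBlockProp fun t => b t < b r).det) :
    ∃ v : {t // b t < b r} → R, ∀ c : {t // b t < b r}, ∑ t, v t * M t c = -M r c := by
  set A := M.toSquareBlockProp fun t => b t < b r
  let w : {t // b t < b r} → R := fun c => -M r c
  refine ⟨w ᵥ* A⁻¹, fun c => ?_⟩
  have hvA : (w ᵥ* A⁻¹) ᵥ* A = w := by
    rw [Matrix.vecMul_vecMul, Matrix.nonsing_inv_mul _ hM, Matrix.vecMul_one]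
  exact congrFun hvA c

theorem exists_lower_mul_blockTriangular [Fintype m] (M : Matrix m m R)
    (hM : ∀ r, IsUnit (M.toSquareBlockProp fun t => b t < b r).det) :
    ∃ L : Matrix m m R, L.BlockTriangular (toDual ∘ b) ∧ (∀ r, L r r = 1) ∧
      (L * M).BlockTriangular b := by
  choose v hv using fun r => exists_row_combination M r (hM r)
  let X : Matrix m m R := Matrix.of fun r t => if h : b t < b r then v r ⟨t, h⟩ else 0
  have hX_zero : ∀ r t, ¬ b t < b r → X r t = 0 := fun r t h => dif_neg h
  have hX_mul : ∀ r c, b c < b r → (X * M) r c = -M r c := by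
    intro r c hc
    rw [Matrix.mul_apply, ← Fintype.sum_subtype_add_sum_subtype (fun t => b t < b r),
      Fintype.sum_eq_zero (fun t : {t // ¬ b t < b r} => X r t * M t c)
        fun t => by rw [hX_zero r t t.2, zero_mul],
      add_zero, ← hv r ⟨c, hc⟩]
    exact Fintype.sum_congr _ _ fun t => by simp only [X, Matrix.of_apply, dif_pos t.2]
  refine ⟨1 + X, ?_, fun r => ?_, fun r c hc => ?_⟩
  · intro r t h
    have hrt : b r < b t := toDual_lt_toDual.mp h
    rw [Matrix.add_apply, Matrix.one_apply_ne (ne_of_apply_ne b hrt.ne), hX_zero r t hrt.not_gt,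
      add_zero]
  · rw [Matrix.add_apply, Matrix.one_apply_eq, hX_zero r r (lt_irrefl _), add_zero]
  · rw [add_mul, one_mul, Matrix.add_apply, hX_mul r c hc, add_neg_cancel]

theorem exists_eq_lower_mul_upper [Fintype m] (hb : b.Injective) (M : Matrix m m R)
    (hM : ∀ r, IsUnit (M.toSquareBlockProp fun t => b t < b r).det) :
    ∃ K P : Matrix m m R, K.BlockTriangular (toDual ∘ b) ∧ (∀ r, K r r = 1) ∧
      P.BlockTriangular b ∧ M = K * P := by
  obtain ⟨L, hL, hL_diag, hP⟩ := exists_lower_mul_blockTriangular M hM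
  have hb' : (toDual ∘ b).Injective := toDual.injective.comp hb
  have hdet : IsUnit L.det := by
    simp only [det_of_blockTriangular_of_injective hb' hL, hL_diag, Finset.prod_const_one,
      isUnit_one]
  have hinv : L⁻¹.BlockTriangular (toDual ∘ b) := by
    let _ := Matrix.invertibleOfIsUnitDet L hdet
    exact Matrix.blockTriangular_inv_of_blockTriangular hL
  refine ⟨L⁻¹, L * M, hinv, fun r => ?_, hP, (Matrix.nonsing_inv_mul_cancel_left _ M hdet).symm⟩
  have hdiag := blockTriangular_mul_apply_self hb' hinv hL r
  rwa [Matrix.nonsing_inv_mul _ hdet, Matrix.one_apply_eq, hL_diag, mul_one, eq_comm] at hdiag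

end Matrices

section Signs

variable {α m m' : Type*} (R : Type*) [CommRing R] {k : ℕ}

/-- The sign of a pair `(p, q)`: it is `-1` if the pair is an inversion. -/
def orderSign [LinearOrder α] (p q : α) : R := if q < p then -1 else 1

/-- The sign of a finite sequence, `(-1)` to the number of its inversions. On injective sequences
it is the sign of the permutation that sorts the sequence, see `inversionSign_comp_perm`. -/
def inversionSign [LinearOrder α] (ρ : Fin k → α) : R :=
  ∏ a, ∏ b ∈ Finset.Iio a, orderSign R (ρ b) (ρ a)

theorem orderSign_mul_self [LinearOrder α] (p q : α) : orderSign R p q * orderSign R p q = 1 := by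
  unfold orderSign
  split_ifs <;> ring

theorem inversionSign_of_strictMono [LinearOrder α] {ρ : Fin k → α} (hρ : StrictMono ρ) :
    inversionSign R ρ = 1 :=
  Finset.prod_eq_one fun _ _ => Finset.prod_eq_one fun _ hb =>
    if_neg (hρ (Finset.mem_Iio.mp hb)).not_gt

theorem inversionSign_of_strictAnti [LinearOrder α] {ρ : Fin k → α} (hρ : StrictAnti ρ) :
    inversionSign R ρ = ∏ a : Fin k, (-1) ^ (a : ℕ) := by
  refine Finset.prod_congr rfl fun a _ => ?_
  have hsign : ∀ b ∈ Finset.Iio a, orderSign R (ρ b) (ρ a) = -1 := fun b hb =>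
    if_pos (hρ (Finset.mem_Iio.mp hb))
  rw [Finset.prod_congr rfl hsign, Finset.prod_const, Fin.card_Iio]

theorem inversionSign_comp_perm [LinearOrder α] {ρ : Fin k → α} (hρ : ρ.Injective)
    (τ : Equiv.Perm (Fin k)) :
    inversionSign R (ρ ∘ τ) = (Equiv.Perm.sign τ : ℤ) * inversionSign R ρ := by
  let F : Fin k → Fin k → R := fun a b => if a = b then 0 else orderSign R (ρ a) (ρ b)
  have hF_antisymm : ∀ a b, F a b = -F b a := by
    intro a b
    rcases eq_or_ne a b with rfl | hab
    · simp [F]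
    · simp only [F, if_neg hab, if_neg hab.symm, orderSign]
      rcases lt_or_gt_of_ne (hρ.ne hab) with h | h <;> simp [h, h.not_gt]
  have hF_of_lt : ∀ {a b}, a ≠ b → F a b = orderSign R (ρ a) (ρ b) := fun h => if_neg h
  calc inversionSign R (ρ ∘ τ) = ∏ a, ∏ b ∈ Finset.Iio a, F (τ b) (τ a) :=
        Finset.prod_congr rfl fun a _ => Finset.prod_congr rfl fun b hb =>
          (hF_of_lt (τ.injective.ne (Finset.mem_Iio.mp hb).ne)).symm
    _ = (Equiv.Perm.sign τ : ℤ) * ∏ a, ∏ b ∈ Finset.Iio a, F b a :=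
        τ.prod_Iio_comp_eq_sign_mul_prod hF_antisymm
    _ = _ := by
        congr 1
        exact Finset.prod_congr rfl fun a _ => Finset.prod_congr rfl fun b hb =>
          hF_of_lt (Finset.mem_Iio.mp hb).ne

theorem exists_eq_comp_perm_of_range_eq {ι : Type*} [Finite ι] {ρ ρ' : ι → α}
    (hρ' : ρ'.Injective) (h : Set.range ρ = Set.range ρ') :
    ∃ τ : Equiv.Perm ι, ρ' = ρ ∘ τ := by
  choose τ hτ using fun a => (h ▸ Set.mem_range_self a : ρ' a ∈ Set.range ρ)
  have hτ_inj : τ.Injective := fun a b hab => hρ' (by rw [← hτ, ← hτ, hab])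
  exact ⟨Equiv.ofBijective τ (Finite.injective_iff_bijective.mp hτ_inj),
    funext fun a => (hτ a).symm⟩

variable {R} [LinearOrder α] {b : m → α}

theorem inversionSign_mul_det_rows (hb : b.Injective) (M : Matrix m m' R)
    {ρ ρ' : Fin k → m} (σ : Fin k → m') (hρ : ρ.Injective) (hρ' : ρ'.Injective)
    (h : Set.range ρ = Set.range ρ') :
    inversionSign R (b ∘ ρ') * (M.submatrix ρ' σ).det =
      inversionSign R (b ∘ ρ) * (M.submatrix ρ σ).det := by
  obtain ⟨τ, rfl⟩ := exists_eq_comp_perm_of_range_eq hρ' h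
  have hsign : ((Equiv.Perm.sign τ : ℤ) : R) * ((Equiv.Perm.sign τ : ℤ) : R) = 1 := by
    rw [← Int.cast_mul, ← Units.val_mul, Int.units_mul_self, Units.val_one, Int.cast_one]
  have hdet : (M.submatrix (ρ ∘ τ) σ).det = (Equiv.Perm.sign τ : ℤ) * (M.submatrix ρ σ).det :=
    Matrix.det_permute τ (M.submatrix ρ σ)
  rw [← Function.comp_assoc, inversionSign_comp_perm R (hb.comp hρ), hdet]
  linear_combination (inversionSign R (b ∘ ρ) * (M.submatrix ρ σ).det) * hsign

theorem inversionSign_mul_det_cols (hb : b.Injective) (M : Matrix m' m R)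
    {σ σ' : Fin k → m} (ρ : Fin k → m') (hσ : σ.Injective) (hσ' : σ'.Injective)
    (h : Set.range σ = Set.range σ') :
    inversionSign R (b ∘ σ') * (M.submatrix ρ σ').det =
      inversionSign R (b ∘ σ) * (M.submatrix ρ σ).det := by
  rw [← Matrix.det_transpose, ← Matrix.det_transpose (M.submatrix ρ σ)]
  exact inversionSign_mul_det_rows hb Mᵀ ρ hσ hσ' h

end Signs

/-- The involution `i ↔ ī` of the index set `J n`. -/
def bar (j : J n) : J n := j.swap

/-- The index that follows `i` in the order `1 < ⋯ < n < n̄ < ⋯ < 1̄`. -/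
def up (i : Fin n) : J n := if h : (i : ℕ) + 1 < n then Sum.inl ⟨i + 1, h⟩ else Sum.inr i

@[simp] theorem bar_bar (j : J n) : bar (bar j) = j := Sum.swap_swap j

theorem bar_injective : Function.Injective (bar : J n → J n) :=
  Function.LeftInverse.injective bar_bar

theorem bar_inl (i : Fin n) : bar (Sum.inl i) = (Sum.inr i : J n) := rfl

theorem bar_inr (i : Fin n) : bar (Sum.inr i) = (Sum.inl i : J n) := rfl

theorem bar_ne (j : J n) : bar j ≠ j := by
  rcases j with i | i <;> simp [bar]

theorem up_of_lt {i : Fin n} (h : (i : ℕ) + 1 < n) : up i = Sum.inl ⟨i + 1, h⟩ := dif_pos h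

theorem up_of_le {i : Fin n} (h : n ≤ (i : ℕ) + 1) : up i = Sum.inr i := dif_neg h.not_gt

@[simp] theorem rank_inl (i : Fin n) : rank (Sum.inl i) = i := rfl

@[simp] theorem rank_inr (i : Fin n) : rank (Sum.inr i) = 2 * n - 1 - i := rfl

theorem rank_lt (j : J n) : rank j < 2 * n := by
  rcases j with i | i <;> simp only [rank_inl, rank_inr] <;> omega

theorem rank_bar (j : J n) : rank (bar j) = 2 * n - 1 - rank j := by
  rcases j with i | i <;> simp only [bar_inl, bar_inr, rank_inl, rank_inr]; omega

theorem rank_bar_lt_rank_bar {p q : J n} : rank (bar p) < rank (bar q) ↔ rank q < rank p := by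
  have := rank_lt p
  have := rank_lt q
  rw [rank_bar, rank_bar]
  omega

theorem rank_up (i : Fin n) : rank (up i) = i + 1 := by
  rcases lt_or_ge ((i : ℕ) + 1) n with h | h
  · rw [up_of_lt h, rank_inl]
  · rw [up_of_le h, rank_inr]; omega

theorem rank_injective : Function.Injective (rank : J n → ℕ) := by
  rintro (a | a) (b | b) h <;> simp only [rank_inl, rank_inr] at h
  · rw [Fin.ext h]
  · omega
  · omega
  · rw [Fin.ext (show (a : ℕ) = b by omega)]

theorem inl_ne_up (i : Fin n) : Sum.inl i ≠ up i :=
  ne_of_apply_ne rank (by rw [rank_up, rank_inl]; omega)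

/-- The permutation of `J n` that interchanges `p` with `q` and `p̄` with `q̄`. -/
def barSwap (p q : J n) : Equiv.Perm (J n) :=
  Function.Involutive.toPerm
    (fun j => if j = p then q else if j = q then p
      else if j = bar q then bar p else if j = bar p then bar q else j)
    (fun j => by grind [bar_bar, bar_ne])

theorem barSwap_apply (p q j : J n) : barSwap p q j =
    if j = p then q else if j = q then p
    else if j = bar q then bar p else if j = bar p then bar q else j := rfl

theorem barSwap_left (p q : J n) : barSwap p q p = q := if_pos rfl

theorem barSwap_bar (p q j : J n) : barSwap p q (bar j) = bar (barSwap p q j) := by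
  simp only [barSwap_apply]
  grind [bar_bar, bar_ne]

theorem barSwap_bar_bar (p q : J n) : barSwap (bar q) (bar p) = barSwap p q := by
  ext1 j
  simp only [barSwap_apply, bar_bar]
  grind [bar_bar, bar_ne]

theorem map_barSwap {g : Equiv.Perm (J n)} (hg : ∀ j, g (bar j) = bar (g j)) (p q j : J n) :
    g (barSwap p q j) = barSwap (g p) (g q) (g j) := by
  simp only [barSwap_apply, ← hg, g.injective.eq_iff]
  split_ifs <;> rfl

/-- The permutation of `J n` given by the simple reflection `s_i` acting on the weights of the
vector representation. -/
def reflPerm (i : Fin n) : Equiv.Perm (J n) := barSwap (Sum.inl i) (up i)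

@[simp] theorem reflPerm_inv (i : Fin n) : (reflPerm i)⁻¹ = reflPerm i := rfl

@[simp] theorem reflPerm_reflPerm (i : Fin n) (j : J n) : reflPerm i (reflPerm i j) = j :=
  (reflPerm i).symm_apply_apply j

theorem reflPerm_mul_self (i : Fin n) : reflPerm i * reflPerm i = 1 :=
  Equiv.ext (reflPerm_reflPerm i)

theorem reflPerm_inl (i : Fin n) : reflPerm i (Sum.inl i) = up i := barSwap_left _ _

theorem reflPerm_up (i : Fin n) : reflPerm i (up i) = Sum.inl i := by
  rw [← reflPerm_inl, reflPerm_reflPerm]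

theorem reflPerm_bar (i : Fin n) (j : J n) : reflPerm i (bar j) = bar (reflPerm i j) :=
  barSwap_bar _ _ j

theorem reflPerm_inr (i : Fin n) : reflPerm i (Sum.inr i) = bar (up i) := by
  rw [← bar_inl, reflPerm_bar, reflPerm_inl]

theorem rank_reflPerm (i : Fin n) (j : J n) : rank (reflPerm i j) =
    if rank j = i then (i : ℕ) + 1 else if rank j = i + 1 then i
    else if rank j = 2 * n - 2 - i then 2 * n - 1 - i
    else if rank j = 2 * n - 1 - i then 2 * n - 2 - i else rank j := by
  have hbar_up : 2 * n - 1 - ((i : ℕ) + 1) = 2 * n - 2 - i := by omega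
  simp only [reflPerm, barSwap_apply, ← rank_injective.eq_iff, apply_ite rank, rank_bar, rank_up,
    rank_inl, hbar_up]

/-- `e_i` does not kill `v_j`; it then maps `v_j` to the basis vector with index `reflPerm i j`. -/
def Raises (i : Fin n) (j : J n) : Prop := j = up i ∨ j = Sum.inr i

instance (i : Fin n) (j : J n) : Decidable (Raises i j) := inferInstanceAs (Decidable (_ ∨ _))

theorem Raises.rank_reflPerm_lt {i : Fin n} {j : J n} (h : Raises i j) :
    rank (reflPerm i j) < rank j := by
  rcases h with rfl | rfl
  · rw [reflPerm_up, rank_up, rank_inl]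
    omega
  · rw [reflPerm_inr, rank_bar, rank_up, rank_inr]
    omega

theorem Raises.not_raises_reflPerm {i : Fin n} {j : J n} (h : Raises i j) :
    ¬Raises i (reflPerm i j) := fun h' => by
  have hlt := h'.rank_reflPerm_lt
  rw [reflPerm_reflPerm] at hlt
  exact hlt.not_gt h.rank_reflPerm_lt

theorem raises_reflPerm_iff {i : Fin n} {j : J n} :
    Raises i (reflPerm i j) ↔ j = Sum.inl i ∨ j = bar (up i) := by
  rw [Raises, ← reflPerm_inl, ← bar_inl, (reflPerm i).apply_eq_iff_eq, reflPerm_inl,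
    ← Equiv.Perm.eq_inv_iff_eq, reflPerm_inv, reflPerm_bar, reflPerm_inl]

theorem reflPerm_eq_self {i : Fin n} {j : J n} (h : ¬Raises i j)
    (h' : ¬Raises i (reflPerm i j)) : reflPerm i j = j := by
  rw [raises_reflPerm_iff] at h'
  rw [Raises] at h
  push Not at h h'
  rw [reflPerm, barSwap_apply, if_neg h'.1, if_neg h.1, if_neg h'.2, bar_inl,
    if_neg h.2]

theorem raises_of_rank_lt_of_rank_reflPerm_lt {i : Fin n} {p q : J n} (h : rank p < rank q)
    (h' : rank (reflPerm i q) < rank (reflPerm i p)) : Raises i q ∧ p = reflPerm i q := by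
  have := rank_lt p
  have := rank_lt q
  simp only [Raises, ← rank_injective.eq_iff, rank_up, rank_inr, rank_reflPerm] at h' ⊢
  split_ifs at h' ⊢ <;> omega

/-- The permutation of `J n` given by a word in the simple reflections. -/
def wordPerm (l : List (Fin n)) : Equiv.Perm (J n) := (l.map reflPerm).prod

@[simp] theorem wordPerm_nil : wordPerm ([] : List (Fin n)) = 1 := rfl

@[simp] theorem wordPerm_cons (i : Fin n) (l : List (Fin n)) :
    wordPerm (i :: l) = reflPerm i * wordPerm l := List.prod_cons

theorem wordPerm_append (l l' : List (Fin n)) :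
    wordPerm (l ++ l') = wordPerm l * wordPerm l' := by
  rw [wordPerm, List.map_append, List.prod_append, wordPerm, wordPerm]

theorem wordPerm_bar (l : List (Fin n)) (j : J n) :
    wordPerm l (bar j) = bar (wordPerm l j) := by
  induction l with
  | nil => rfl
  | cons i l ih => rw [wordPerm_cons, Equiv.Perm.mul_apply, ih, reflPerm_bar, Equiv.Perm.mul_apply]

theorem wordPerm_inv_bar (l : List (Fin n)) (j : J n) :
    (wordPerm l)⁻¹ (bar j) = bar ((wordPerm l)⁻¹ j) := by
  rw [Equiv.Perm.inv_eq_iff_eq, wordPerm_bar, Equiv.Perm.inv_def, Equiv.apply_symm_apply]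

theorem rank_perm_up_ne (g : Equiv.Perm (J n)) (i : Fin n) :
    rank (g (up i)) ≠ rank (g (Sum.inl i)) :=
  rank_injective.ne (g.injective.ne (inl_ne_up i).symm)

theorem reflPerm_mul_mul_reflPerm {g : Equiv.Perm (J n)} (hg : ∀ j, g (bar j) = bar (g j))
    {i k : Fin n} (h : rank (g⁻¹ (Sum.inl i)) < rank (g⁻¹ (up i)))
    (h' : rank (reflPerm k (g⁻¹ (up i))) < rank (reflPerm k (g⁻¹ (Sum.inl i)))) :
    reflPerm i * g * reflPerm k = g := by
  have hconj : ∀ j, g (reflPerm k j) = reflPerm i (g j) := by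
    intro j
    obtain ⟨hq | hq, hp⟩ := raises_of_rank_lt_of_rank_reflPerm_lt h h'
    · rw [hq, reflPerm_up, Equiv.Perm.inv_eq_iff_eq] at hp
      rw [Equiv.Perm.inv_eq_iff_eq] at hq
      rw [reflPerm, map_barSwap hg, ← hp, ← hq, reflPerm]
    · rw [hq, reflPerm_inr, Equiv.Perm.inv_eq_iff_eq] at hp
      rw [Equiv.Perm.inv_eq_iff_eq] at hq
      rw [reflPerm, ← barSwap_bar_bar, map_barSwap hg, bar_inl, ← hp, ← hq, reflPerm]
  ext1 j
  rw [Equiv.Perm.mul_apply, Equiv.Perm.mul_apply, hconj, reflPerm_reflPerm]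

-- The deleted letter is the first one at which the order of the two preimages is reversed.
theorem exchange_of_append (i : Fin n) (l l₀ : List (Fin n))
    (h₀ : rank ((wordPerm l₀)⁻¹ (Sum.inl i)) < rank ((wordPerm l₀)⁻¹ (up i)))
    (h : rank ((wordPerm (l₀ ++ l))⁻¹ (up i)) < rank ((wordPerm (l₀ ++ l))⁻¹ (Sum.inl i))) :
    ∃ l', l'.length + 1 = l.length ∧
      reflPerm i * wordPerm (l₀ ++ l) = wordPerm (l₀ ++ l') := by
  induction l generalizing l₀ with
  | nil => rw [List.append_nil] at h; omega
  | cons k l ih =>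
    rcases (rank_perm_up_ne (wordPerm (l₀ ++ [k]))⁻¹ i).lt_or_gt with hk | hk
    · have hconj : reflPerm i * wordPerm l₀ * reflPerm k = wordPerm l₀ := by
        refine reflPerm_mul_mul_reflPerm (wordPerm_bar l₀) h₀ ?_
        simpa only [wordPerm_append, wordPerm_cons, wordPerm_nil, mul_one, mul_inv_rev,
          reflPerm_inv, Equiv.Perm.mul_apply] using hk
      refine ⟨l, rfl, ?_⟩
      rw [wordPerm_append, wordPerm_cons, wordPerm_append, ← mul_assoc, ← mul_assoc, hconj]
    · rw [List.append_cons] at h ⊢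
      obtain ⟨l', hlen, hl'⟩ := ih (l₀ ++ [k]) hk h
      exact ⟨k :: l', by rw [List.length_cons, List.length_cons, hlen],
        by rw [hl', ← List.append_cons]⟩

theorem exchange (i : Fin n) (l : List (Fin n))
    (h : rank ((wordPerm l)⁻¹ (up i)) < rank ((wordPerm l)⁻¹ (Sum.inl i))) :
    ∃ l', l'.length + 1 = l.length ∧ reflPerm i * wordPerm l = wordPerm l' :=
  exchange_of_append i l [] (by simp [rank_up]) h

theorem wt_bar (j : J n) : wt (bar j) = -wt j := by
  rcases j with i | i <;> ext k <;> simp only [bar_inl, bar_inr, wt, Pi.neg_apply] <;>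
    split_ifs <;> rfl

theorem wt_inl_apply (a k : Fin n) : wt (Sum.inl a) k =
    (if k = a then 1 else 0) - if (k : ℕ) + 1 = a then 1 else 0 := by
  simp only [wt]
  split_ifs <;> first | rfl | omega

theorem simpleRoot_eq (i : Fin n) : simpleRoot i = wt (Sum.inl i) - wt (up i) := by
  ext k
  rcases lt_or_ge ((i : ℕ) + 1) n with h | h
  · simp only [up_of_lt h, Pi.sub_apply, wt_inl_apply, simpleRoot, cartan, Matrix.of_apply]
    grind
  · simp only [up_of_le h, ← bar_inl, wt_bar, Pi.sub_apply, Pi.neg_apply, wt_inl_apply, simpleRoot,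
      cartan, Matrix.of_apply]
    grind

theorem wt_inl_self (i : Fin n) : wt (Sum.inl i) i = 1 := by simp [wt]

theorem wt_up_self (i : Fin n) : wt (up i) i = -1 := by
  rcases lt_or_ge ((i : ℕ) + 1) n with h | h
  · simp [up_of_lt h, wt, Fin.ext_iff]
  · simp [up_of_le h, wt]

theorem wt_apply_eq_zero {i : Fin n} {j : J n} (hinl : j ≠ Sum.inl i) (hup : j ≠ up i)
    (hbar_up : j ≠ bar (up i)) (hinr : j ≠ Sum.inr i) : wt j i = 0 := by
  simp only [ne_eq, ← rank_injective.eq_iff, rank_bar, rank_up, rank_inl, rank_inr] at *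
  rcases j with a | a <;> simp only [wt, rank_inl, rank_inr, Fin.ext_iff] at * <;>
    split_ifs <;> omega

theorem reflection_apply (i : Fin n) (lam : Weight n) :
    reflection i lam = lam - lam i • simpleRoot i := by
  simp [reflection, Module.reflection_apply]

theorem wt_reflPerm (i : Fin n) (j : J n) : wt (reflPerm i j) = reflection i (wt j) := by
  rw [reflection_apply, simpleRoot_eq, reflPerm, barSwap_apply]
  split_ifs with hinl hup hbar_up hinr
  · rw [hinl, wt_inl_self, one_smul, sub_sub_cancel]
  · rw [hup, wt_up_self, neg_one_smul, sub_neg_eq_add, add_sub_cancel]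
  · rw [hbar_up, wt_bar, wt_bar, Pi.neg_apply, wt_up_self, neg_neg, one_smul]
    abel
  · rw [hinr, wt_bar, wt_bar, Pi.neg_apply, wt_inl_self, neg_one_smul]
    abel
  · rw [wt_apply_eq_zero hinl hup hbar_up hinr, zero_smul, sub_zero]

theorem wt_wordPerm (l : List (Fin n)) (j : J n) :
    wt (wordPerm l j) = ((l.map s).prod : Weight n ≃ₗ[ℤ] Weight n) (wt j) := by
  induction l with
  | nil => rfl
  | cons i l ih =>
    rw [wordPerm_cons, Equiv.Perm.mul_apply, wt_reflPerm, ih, List.map_cons, List.prod_cons]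
    rfl

/-- The coordinate of a weight with respect to `wt v_i`, in the basis `wt v_1, …, wt v_n`. -/
def epsCoord (i : Fin n) : Weight n →ₗ[ℤ] ℤ := ∑ k ∈ Finset.Ici i, LinearMap.proj k

theorem epsCoord_wt_inl (i a : Fin n) :
    epsCoord i (wt (Sum.inl a)) = if i = a then 1 else 0 := by
  rw [epsCoord, LinearMap.sum_apply]
  simp only [LinearMap.proj_apply, wt_inl_apply, Finset.sum_sub_distrib, Finset.sum_ite_eq',
    Finset.mem_Ici]
  rcases Nat.eq_zero_or_pos a with ha | ha
  · have hne : ∀ k : Fin n, (k : ℕ) + 1 ≠ a := by omega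
    simp only [hne, if_false, Finset.sum_const_zero, sub_zero, Fin.le_def, Fin.ext_iff]
    split_ifs <;> first | rfl | omega
  · have hpred : ∀ k : Fin n, (k : ℕ) + 1 = a ↔ k = ⟨a - 1, by omega⟩ := by
      intro k; rw [Fin.ext_iff]; simp only; omega
    simp only [hpred, Finset.sum_ite_eq', Finset.mem_Ici]
    simp only [Fin.le_def, Fin.ext_iff]
    split_ifs <;> first | rfl | omega

theorem epsCoord_wt_inr (i a : Fin n) :
    epsCoord i (wt (Sum.inr a)) = if i = a then -1 else 0 := by
  rw [← bar_inl, wt_bar, map_neg, epsCoord_wt_inl, apply_ite Neg.neg, neg_zero]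

theorem epsCoord_wt (i : Fin n) (j : J n) : epsCoord i (wt j) =
    (if j = Sum.inl i then 1 else 0) - if j = Sum.inr i then 1 else 0 := by
  rcases j with a | a
  · simp only [epsCoord_wt_inl, Sum.inl.injEq, reduceCtorEq, if_false, sub_zero, eq_comm]
  · simp only [epsCoord_wt_inr, Sum.inr.injEq, reduceCtorEq, if_false, zero_sub, eq_comm,
      apply_ite Neg.neg, neg_zero]

theorem wt_injective : Function.Injective (wt : J n → Weight n) := by
  rintro (a | a) (b | b) hw <;> have hcoord := congrArg (epsCoord a) hw <;>
    simp only [epsCoord_wt_inl, epsCoord_wt_inr, if_true] at hcoord <;> grind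

theorem fundWeight_eq_sum (i : Fin n) :
    fundWeight i = ∑ a ∈ Finset.Iic i, wt (Sum.inl a : J n) := by
  ext k
  simp only [fundWeight, Pi.single_apply, Finset.sum_apply, wt_inl_apply, Finset.sum_sub_distrib,
    Finset.sum_ite_eq, Finset.mem_Iic]
  rcases lt_or_ge ((k : ℕ) + 1) n with hk | hk
  · have hsucc : ∀ a : Fin n, (k : ℕ) + 1 = a ↔ ⟨k + 1, hk⟩ = a := by
      intro a; rw [Fin.ext_iff]
    simp only [hsucc, Finset.sum_ite_eq, Finset.mem_Iic]
    simp only [Fin.le_def, Fin.ext_iff]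
    split_ifs <;> first | rfl | omega
  · have hne : ∀ a : Fin n, (k : ℕ) + 1 ≠ a := by omega
    simp only [hne, if_false, Finset.sum_const_zero, sub_zero, Fin.le_def, Fin.ext_iff]
    split_ifs <;> first | rfl | omega

theorem linearMap_ext_wt {M : Type*} [AddCommGroup M] {g g' : Weight n →ₗ[ℤ] M}
    (h : ∀ i : Fin n, g (wt (Sum.inl i)) = g' (wt (Sum.inl i))) : g = g' := by
  refine (Pi.basisFun ℤ (Fin n)).ext fun i => ?_
  have hfund : Pi.basisFun ℤ (Fin n) i = ∑ a ∈ Finset.Iic i, wt (Sum.inl a : J n) := by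
    rw [Pi.basisFun_apply, ← fundWeight_eq_sum, fundWeight]
  simp only [hfund, map_sum, h]

theorem wordPerm_eq_iff {l l' : List (Fin n)} :
    wordPerm l = wordPerm l' ↔ (l.map s).prod = (l'.map s).prod := by
  refine ⟨fun h => ?_, fun h => ?_⟩
  · refine Subtype.ext (LinearEquiv.toLinearMap_injective (linearMap_ext_wt fun i => ?_))
    rw [LinearEquiv.coe_coe, LinearEquiv.coe_coe, ← wt_wordPerm, ← wt_wordPerm, h]
  · ext1 j
    apply wt_injective
    rw [wt_wordPerm, wt_wordPerm, h]

theorem IsReducedWord.tail {i : Fin n} {l : List (Fin n)} {w : weylGroup n}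
    (h : IsReducedWord (i :: l) w) : IsReducedWord l (l.map s).prod := by
  refine ⟨rfl, fun l' hl' => Nat.le_of_succ_le_succ (h.2 (i :: l') ?_)⟩
  rw [← h.1, List.map_cons, List.prod_cons, List.map_cons, List.prod_cons, hl']

theorem IsReducedWord.rank_lt {i : Fin n} {l : List (Fin n)} {w : weylGroup n}
    (h : IsReducedWord (i :: l) w) :
    rank ((wordPerm l)⁻¹ (Sum.inl i)) < rank ((wordPerm l)⁻¹ (up i)) := by
  refine (rank_perm_up_ne _ i).lt_or_gt.resolve_left fun hlt => ?_
  obtain ⟨l', hlen, hl'⟩ := exchange i l hlt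
  have hle := h.2 l' (by rw [← h.1, wordPerm_eq_iff.mp (hl'.symm.trans (wordPerm_cons i l).symm)])
  rw [List.length_cons] at hle
  omega

theorem s_mul_s (i : Fin n) : s i * s i = 1 :=
  Subtype.ext (LinearEquiv.ext (Module.involutive_reflection (proj_simpleRoot i)))

theorem exists_word (w : weylGroup n) : ∃ l : List (Fin n), (l.map s).prod = w := by
  obtain ⟨w, hw⟩ := w
  induction hw using Subgroup.closure_induction with
  | mem _ hmem =>
    obtain ⟨i, rfl⟩ := hmem
    exact ⟨[i], List.prod_singleton⟩
  | one => exact ⟨[], rfl⟩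
  | mul _ _ _ _ ih ih' =>
    obtain ⟨l, hl⟩ := ih
    obtain ⟨l', hl'⟩ := ih'
    exact ⟨l ++ l', by rw [List.map_append, List.prod_append, hl, hl']; rfl⟩
  | inv _ _ ih =>
    obtain ⟨l, hl⟩ := ih
    have hinv : (fun g : weylGroup n => g⁻¹) ∘ s = s :=
      funext fun i => inv_eq_of_mul_eq_one_left (s_mul_s i)
    refine ⟨l.reverse, ?_⟩
    rw [List.map_reverse, ← hinv, ← List.map_map, ← List.prod_inv_reverse, hl]
    rfl

theorem exists_isReducedWord (w : weylGroup n) : ∃ l : List (Fin n), IsReducedWord l w := by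
  obtain ⟨l, hl, hmin⟩ := (measure List.length).wf.has_min {l | (l.map s).prod = w} (exists_word w)
  exact ⟨l, hl, fun l' hl' => not_lt.mp (hmin l' hl')⟩

theorem exists_isLongest (n : ℕ) : ∃ w : weylGroup n, IsLongest w := by
  choose word hword using exists_isReducedWord (n := n)
  have hinj : Function.Injective fun w => wordPerm (word w) := fun w w' h => by
    rw [← (hword w).1, wordPerm_eq_iff.mp h, (hword w').1]
  have : Finite (weylGroup n) := Finite.of_injective _ hinj
  obtain ⟨w, hw⟩ := Finite.exists_max fun w => (word w).length
  exact ⟨w, word w, hword w, fun w' l' hl' => (hl'.2 _ (hword w').1).trans (hw w')⟩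

theorem rank_lt_of_isReducedWord_maximal {w : weylGroup n} {l : List (Fin n)}
    (hl : IsReducedWord l w)
    (hmax : ∀ (w' : weylGroup n) l', IsReducedWord l' w' → l'.length ≤ l.length) (i : Fin n) :
    rank ((wordPerm l)⁻¹ (up i)) < rank ((wordPerm l)⁻¹ (Sum.inl i)) := by
  refine (rank_perm_up_ne _ i).lt_or_gt.resolve_right fun hlt => ?_
  obtain ⟨l', hl'⟩ := exists_isReducedWord (s i * w)
  have hperm : wordPerm l' = reflPerm i * wordPerm l := by
    rw [← wordPerm_cons, wordPerm_eq_iff, hl'.1, List.map_cons, List.prod_cons, hl.1]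
  obtain ⟨l'', hlen, hl''⟩ := exchange i l' (by
    rw [hperm, mul_inv_rev, Equiv.Perm.mul_apply, Equiv.Perm.mul_apply, reflPerm_inv, reflPerm_up,
      reflPerm_inl]
    exact hlt)
  have hprod : wordPerm l'' = wordPerm l := by
    rw [← hl'', hperm, ← mul_assoc, reflPerm_mul_self, one_mul]
  have hle := hl.2 l'' (by rw [wordPerm_eq_iff.mp hprod, hl.1])
  have hge := hmax _ l' hl'
  omega

theorem rank_apply_inl_add_le {g : J n → J n} (h : ∀ i, rank (g (up i)) < rank (g (Sum.inl i)))
    (k : ℕ) (hk : k < n) : rank (g (Sum.inl ⟨k, hk⟩)) + k ≤ 2 * n - 1 := by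
  induction k with
  | zero =>
    have := rank_lt (g (Sum.inl ⟨0, hk⟩))
    omega
  | succ k ih =>
    have hle := ih (by omega)
    have hlt := h ⟨k, by omega⟩
    rw [up_of_lt hk] at hlt
    simp only at hlt
    omega

theorem le_rank_apply_inl {g : J n → J n} (hg : ∀ j, g (bar j) = bar (g j))
    (h : ∀ i, rank (g (up i)) < rank (g (Sum.inl i))) (m : ℕ) {k : ℕ} (hk : k < n)
    (hkm : k + 1 + m = n) : n + m ≤ rank (g (Sum.inl ⟨k, hk⟩)) := by
  induction m generalizing k with
  | zero =>
    have hlt := h ⟨k, hk⟩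
    rw [up_of_le (by simp only; omega), ← bar_inl, hg, rank_bar] at hlt
    omega
  | succ m ih =>
    have hle := ih (k := k + 1) (by omega) (by omega)
    have hlt := h ⟨k, hk⟩
    rw [up_of_lt (by simp only; omega)] at hlt
    simp only at hlt
    omega

theorem eq_bar_of_rank_apply_up_lt {g : J n → J n} (hg : ∀ j, g (bar j) = bar (g j))
    (h : ∀ i, rank (g (up i)) < rank (g (Sum.inl i))) : g = bar := by
  have hinl (i : Fin n) : g (Sum.inl i) = bar (Sum.inl i) := by
    apply rank_injective
    have hle := rank_apply_inl_add_le h i i.2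
    have hge := le_rank_apply_inl hg h (n - 1 - i) i.2 (by omega)
    rw [Fin.eta] at hle hge
    rw [rank_bar, rank_inl]
    omega
  ext1 j
  rcases j with i | i
  · exact hinl i
  · rw [← bar_inl, hg, hinl]

theorem w₀_apply (lam : Weight n) : (w₀ n : Weight n ≃ₗ[ℤ] Weight n) lam = -lam := by
  obtain ⟨l, hl, hmax⟩ : IsLongest (w₀ n) := Classical.epsilon_spec (exists_isLongest n)
  have hinv := eq_bar_of_rank_apply_up_lt (wordPerm_inv_bar l)
    (rank_lt_of_isReducedWord_maximal hl hmax)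
  have hperm (j : J n) : wordPerm l j = bar j := by
    rw [← Equiv.Perm.eq_inv_iff_eq, hinv, bar_bar]
  have hneg : ((w₀ n : Weight n ≃ₗ[ℤ] Weight n) : Weight n →ₗ[ℤ] Weight n) = -LinearMap.id := by
    refine linearMap_ext_wt fun i => ?_
    rw [LinearEquiv.coe_coe, ← hl.1, ← wt_wordPerm, hperm, wt_bar]
    rfl
  exact LinearMap.congr_fun hneg lam

@[simp] theorem mat_mul (g h : G n) : mat (g * h) = mat g * mat h := rfl

@[simp] theorem mat_one : mat (1 : G n) = 1 := rfl

theorem mat_injective : Function.Injective (mat : G n → Matrix (J n) (J n) ℂ) := fun _ _ h =>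
  Subtype.ext (Units.ext h)

theorem mat_x (i : Fin n) (a : ℂ) : mat (x i a) = 1 + a • e i :=
  exp_of_sq_eq_zero _ (by simp [e_mul_e])

theorem mat_y (i : Fin n) (a : ℂ) : mat (y i a) = 1 + a • f i :=
  exp_of_sq_eq_zero _ (by simp [f_mul_f])

theorem e_apply (i : Fin n) (r t : J n) :
    e i r t = if Raises i t ∧ r = reflPerm i t then 1 else 0 := by
  have hiff : (Raises i t ∧ r = reflPerm i t) ↔
      (r = Sum.inl i ∧ t = up i) ∨ (r = bar (up i) ∧ t = Sum.inr i) := by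
    constructor
    · rintro ⟨rfl | rfl, rfl⟩
      · exact Or.inl ⟨reflPerm_up i, rfl⟩
      · exact Or.inr ⟨reflPerm_inr i, rfl⟩
    · rintro (⟨rfl, rfl⟩ | ⟨rfl, rfl⟩)
      · exact ⟨Or.inl rfl, (reflPerm_up i).symm⟩
      · exact ⟨Or.inr rfl, (reflPerm_inr i).symm⟩
  rw [if_congr hiff rfl rfl]
  simp only [← rank_injective.eq_iff, rank_bar, rank_up, rank_inl, rank_inr]
  rcases r with a | a <;> rcases t with b | b <;>
    simp only [e, Matrix.of_apply, rank_inl, rank_inr, Fin.ext_iff] <;> grind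

theorem f_apply (i : Fin n) (r t : J n) :
    f i r t = if Raises i (reflPerm i t) ∧ r = reflPerm i t then 1 else 0 := by
  have hiff : t = reflPerm i r ↔ r = reflPerm i t := by
    rw [← Equiv.Perm.inv_eq_iff_eq, reflPerm_inv, eq_comm]
  rw [f, Matrix.transpose_apply, e_apply]
  refine if_congr ?_ rfl rfl
  rw [hiff]
  exact and_congr_left (by rintro rfl; rfl)

theorem e_mul_f (i : Fin n) :
    e i * f i = Matrix.diagonal fun j => if Raises i (reflPerm i j) then 1 else 0 := by
  ext r t
  rw [Matrix.mul_apply, Finset.sum_eq_single (reflPerm i t)]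
  · rw [e_apply, f_apply, reflPerm_reflPerm, Matrix.diagonal_apply]
    grind
  · intro j _ hj
    rw [f_apply, if_neg fun h => hj h.2, mul_zero]
  · exact fun h => absurd (Finset.mem_univ _) h

theorem f_mul_e (i : Fin n) :
    f i * e i = Matrix.diagonal fun j => if Raises i j then 1 else 0 := by
  ext r t
  rw [Matrix.mul_apply, Finset.sum_eq_single (reflPerm i t)]
  · rw [e_apply, f_apply, reflPerm_reflPerm, Matrix.diagonal_apply]
    grind
  · intro j _ hj
    rw [e_apply, if_neg fun h => hj h.2, mul_zero]
  · exact fun h => absurd (Finset.mem_univ _) h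

/-- The sign with which the representative of `s_i` moves the basis vector `v_j`. -/
def reflSign (i : Fin n) (j : J n) : ℂ := if Raises i j then -1 else 1

theorem e_mul_f_mul_e (i : Fin n) : e i * f i * e i = e i := by
  ext r t
  rw [e_mul_f, Matrix.diagonal_mul, e_apply]
  split_ifs <;> grind [reflPerm_reflPerm]

theorem mat_sBar_eq (i : Fin n) : mat (sBar i) = 1 + f i - e i - e i * f i - f i * e i := by
  simp only [sBar, mat_mul, mat_x, mat_y, neg_smul, one_smul, mul_add, add_mul, mul_one, one_mul,
    neg_mul, mul_neg, e_mul_e, mul_assoc]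
  simp only [← mul_assoc, e_mul_f_mul_e]
  abel

theorem mat_sBar_apply (i : Fin n) (r t : J n) :
    mat (sBar i) r t = if r = reflPerm i t then reflSign i t else 0 := by
  have hexcl : Raises i t → ¬Raises i (reflPerm i t) := Raises.not_raises_reflPerm
  have hfix : ¬Raises i t → ¬Raises i (reflPerm i t) → reflPerm i t = t := reflPerm_eq_self
  rw [mat_sBar_eq, e_mul_f, f_mul_e]
  simp only [Matrix.sub_apply, Matrix.add_apply, Matrix.one_apply, Matrix.diagonal_apply, e_apply,
    f_apply, reflSign]
  by_cases ht : Raises i t <;> by_cases ht' : Raises i (reflPerm i t) <;>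
    by_cases hrt : r = t <;> grind

/-- The sign with which the representative of `w` moves the basis vector `v_a`. -/
def permSign (w : Equiv.Perm (J n)) (a : J n) : ℂ :=
  ∏ b with rank b < rank a, orderSign ℂ (rank (w b)) (rank (w a))

theorem permSign_mul_self (w : Equiv.Perm (J n)) (a : J n) :
    permSign w a * permSign w a = 1 := by
  simp only [permSign, ← Finset.prod_mul_distrib, orderSign_mul_self, Finset.prod_const_one]

theorem permSign_one (a : J n) : permSign 1 a = 1 :=
  Finset.prod_eq_one fun _ hb => if_neg (Finset.mem_filter.mp hb).2.not_gt

theorem orderSign_reflPerm {i : Fin n} {p q : J n} (hne : p ≠ q)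
    (h : Raises i p → q ≠ reflPerm i p) :
    orderSign ℂ (rank (reflPerm i p)) (rank (reflPerm i q)) =
      (if Raises i q ∧ p = reflPerm i q then -1 else 1) * orderSign ℂ (rank p) (rank q) := by
  have hne' := rank_injective.ne ((reflPerm i).injective.ne hne)
  rcases (rank_injective.ne hne).lt_or_gt with hlt | hlt
  · rw [orderSign, orderSign, if_neg hlt.not_gt, mul_one]
    refine if_congr ⟨raises_of_rank_lt_of_rank_reflPerm_lt hlt, ?_⟩ rfl rfl
    rintro ⟨hq, rfl⟩
    rw [reflPerm_reflPerm]
    exact hq.rank_reflPerm_lt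
  · have hlt' : rank (reflPerm i q) < rank (reflPerm i p) := hne'.lt_or_gt.resolve_left fun hc =>
      have ⟨hp, hqp⟩ := raises_of_rank_lt_of_rank_reflPerm_lt hlt hc
      h hp hqp
    have hnot : ¬(Raises i q ∧ p = reflPerm i q) := by
      rintro ⟨hq, rfl⟩
      exact hlt.not_gt hq.rank_reflPerm_lt
    rw [if_neg hnot, one_mul, orderSign, orderSign, if_pos hlt, if_pos hlt']

theorem Raises.rank_inv_reflPerm_lt {i : Fin n} {w : Equiv.Perm (J n)} {j : J n}
    (hj : Raises i j) (hw : ∀ j, w⁻¹ (bar j) = bar (w⁻¹ j))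
    (h : rank (w⁻¹ (Sum.inl i)) < rank (w⁻¹ (up i))) :
    rank (w⁻¹ (reflPerm i j)) < rank (w⁻¹ j) := by
  rcases hj with rfl | rfl
  · rwa [reflPerm_up]
  · rwa [reflPerm_inr, ← bar_inl, hw, hw, rank_bar_lt_rank_bar]

theorem permSign_reflPerm_mul {i : Fin n} {w : Equiv.Perm (J n)}
    (hw : ∀ j, w⁻¹ (bar j) = bar (w⁻¹ j))
    (h : rank (w⁻¹ (Sum.inl i)) < rank (w⁻¹ (up i))) (a : J n) :
    permSign (reflPerm i * w) a = reflSign i (w a) * permSign w a := by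
  have hraise {q : J n} (hq : Raises i q) := hq.rank_inv_reflPerm_lt hw h
  have hinv (j : J n) : w⁻¹ (w j) = j := w.symm_apply_apply j
  have hfactor : ∀ b ∈ Finset.univ.filter fun b => rank b < rank a,
      orderSign ℂ (rank ((reflPerm i * w) b)) (rank ((reflPerm i * w) a)) =
        (if Raises i (w a) ∧ w b = reflPerm i (w a) then -1 else 1) *
          orderSign ℂ (rank (w b)) (rank (w a)) := by
    intro b hb
    rw [Finset.mem_filter] at hb
    refine orderSign_reflPerm (w.injective.ne (ne_of_apply_ne rank hb.2.ne)) fun hwb hwa => ?_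
    have hlt := hraise hwb
    rw [← hwa, hinv, hinv] at hlt
    exact hlt.not_gt hb.2
  rw [permSign, Finset.prod_congr rfl hfactor, Finset.prod_mul_distrib, permSign]
  congr 1
  by_cases ha : Raises i (w a)
  · have hlt := hraise ha
    rw [hinv] at hlt
    simp only [ha, true_and, ← Equiv.Perm.eq_inv_iff_eq, Finset.prod_ite_eq', Finset.mem_filter,
      Finset.mem_univ, hlt, if_true, reflSign]
  · simp only [ha, false_and, if_false, Finset.prod_const_one, reflSign]

theorem mat_prod_sBar_apply {l : List (Fin n)} {w : weylGroup n} (hl : IsReducedWord l w)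
    (r t : J n) :
    mat (l.map sBar).prod r t = if r = wordPerm l t then permSign (wordPerm l) t else 0 := by
  induction l generalizing r w with
  | nil =>
    rw [wordPerm_nil, permSign_one]
    exact Matrix.one_apply
  | cons i l ih =>
    rw [List.map_cons, List.prod_cons, mat_mul, Matrix.mul_apply]
    simp only [mat_sBar_apply, ih hl.tail, wordPerm_cons, Equiv.Perm.mul_apply,
      permSign_reflPerm_mul (wordPerm_inv_bar l) hl.rank_lt, mul_ite, mul_zero,
      Finset.sum_ite_eq', Finset.mem_univ, if_true, ite_mul, zero_mul]

/-- The sequence of the first `k` indices. -/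
def emb {k : ℕ} (hk : k ≤ n) (a : Fin k) : J n := Sum.inl (Fin.castLE hk a)

theorem rank_emb {k : ℕ} (hk : k ≤ n) (a : Fin k) : rank (emb hk a) = a := rfl

theorem emb_injective {k : ℕ} (hk : k ≤ n) : Function.Injective (emb hk) :=
  Sum.inl_injective.comp (Fin.castLE_injective hk)

theorem filter_rank_lt_rank_emb {k : ℕ} (hk : k ≤ n) (a : Fin k) :
    (Finset.univ.filter fun b : J n => rank b < rank (emb hk a)) =
      (Finset.Iio a).map ⟨emb hk, emb_injective hk⟩ := by
  ext b
  rw [Finset.mem_filter_univ, Finset.mem_map, rank_emb]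
  constructor
  · intro hb
    exact ⟨⟨rank b, hb.trans a.2⟩, Finset.mem_Iio.mpr hb, rank_injective rfl⟩
  · rintro ⟨c, hc, rfl⟩
    exact (Finset.mem_Iio.mp hc : c < a)

theorem prod_permSign_emb {k : ℕ} (hk : k ≤ n) (w : Equiv.Perm (J n)) :
    ∏ a, permSign w (emb hk a) = inversionSign ℂ (rank ∘ w ∘ emb hk) := by
  refine Finset.prod_congr rfl fun a _ => ?_
  rw [permSign, filter_rank_lt_rank_emb, Finset.prod_map]
  rfl

theorem inversionSign_emb {k : ℕ} (hk : k ≤ n) : inversionSign ℂ (rank ∘ emb hk) = 1 :=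
  inversionSign_of_strictMono ℂ Fin.val_strictMono

/-- The leading principal minor of size `k`. -/
def leadingMinor {k : ℕ} (hk : k ≤ n) (M : Matrix (J n) (J n) ℂ) : ℂ :=
  (M.submatrix (emb hk) (emb hk)).det

theorem mat_prod_sBar_inv_mul_apply {l : List (Fin n)} {w : weylGroup n}
    (hl : IsReducedWord l w) (g : G n) (r t : J n) :
    mat ((l.map sBar).prod⁻¹ * g) r t =
      permSign (wordPerm l) r * mat g (wordPerm l r) t := by
  have hrow : mat g (wordPerm l r) t =
      permSign (wordPerm l) r * mat ((l.map sBar).prod⁻¹ * g) r t := by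
    conv_lhs => rw [← mul_inv_cancel_left (l.map sBar).prod g]
    rw [mat_mul, Matrix.mul_apply]
    simp only [mat_prod_sBar_apply hl, (Equiv.injective _).eq_iff, ite_mul, zero_mul,
      Finset.sum_ite_eq, Finset.mem_univ, if_true]
  rw [hrow, ← mul_assoc, permSign_mul_self, one_mul]

theorem mat_mul_prod_sBar_apply {l : List (Fin n)} {w : weylGroup n} (hl : IsReducedWord l w)
    (g : G n) (r t : J n) :
    mat (g * (l.map sBar).prod) r t = permSign (wordPerm l) t * mat g r (wordPerm l t) := by
  rw [mat_mul, Matrix.mul_apply]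
  simp only [mat_prod_sBar_apply hl, mul_ite, mul_zero, Finset.sum_ite_eq', Finset.mem_univ,
    if_true]
  rw [mul_comm]

theorem leadingMinor_conj {k : ℕ} (hk : k ≤ n) {l l' : List (Fin n)} {w w' : weylGroup n}
    (hl : IsReducedWord l w) (hl' : IsReducedWord l' w') (g : G n) :
    leadingMinor hk (mat ((l.map sBar).prod⁻¹ * g * (l'.map sBar).prod)) =
      inversionSign ℂ (rank ∘ wordPerm l ∘ emb hk) *
        (inversionSign ℂ (rank ∘ wordPerm l' ∘ emb hk) *
          ((mat g).submatrix (wordPerm l ∘ emb hk) (wordPerm l' ∘ emb hk)).det) := by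
  have hsigned : (mat ((l.map sBar).prod⁻¹ * g * (l'.map sBar).prod)).submatrix (emb hk) (emb hk) =
      Matrix.of fun a b => permSign (wordPerm l) (emb hk a) *
        (Matrix.of fun a b => permSign (wordPerm l') (emb hk b) *
          (mat g).submatrix (wordPerm l ∘ emb hk) (wordPerm l' ∘ emb hk) a b) a b := by
    ext a b
    rw [Matrix.submatrix_apply, mat_mul_prod_sBar_apply hl', mat_prod_sBar_inv_mul_apply hl]
    exact mul_left_comm _ _ _
  rw [leadingMinor, hsigned, Matrix.det_mul_column, Matrix.det_mul_row, prod_permSign_emb,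
    prod_permSign_emb]

theorem fundWeight_node_eq_sum {k : ℕ} (hk : 1 ≤ k) (hkn : k ≤ n) :
    fundWeight (node n k hk hkn) = ∑ a, wt (emb hkn a) := by
  have hIic : Finset.Iic (node n k hk hkn) = Finset.univ.map (Fin.castLEEmb hkn) := by
    ext i
    simp only [node, Finset.mem_Iic, Fin.le_def, Finset.mem_map, Finset.mem_univ, true_and,
      Fin.ext_iff]
    exact ⟨fun hi => ⟨⟨i, by omega⟩, rfl⟩, fun ⟨a, ha⟩ => by rw [← ha]; exact Nat.le_pred_of_lt a.2⟩
  rw [fundWeight_eq_sum, hIic, Finset.sum_map]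
  rfl

open Classical in
theorem epsCoord_sum_wt {ι : Type*} [Fintype ι] {ρ : ι → J n} (hρ : ρ.Injective) (i : Fin n) :
    epsCoord i (∑ a, wt (ρ a)) =
      (if Sum.inl i ∈ Set.range ρ then 1 else 0) - if Sum.inr i ∈ Set.range ρ then 1 else 0 := by
  have hcount (j : J n) :
      ∑ a, (if ρ a = j then 1 else 0 : ℤ) = if j ∈ Set.range ρ then 1 else 0 := by
    split_ifs with h
    · obtain ⟨b, rfl⟩ := h
      simp only [hρ.eq_iff, Finset.sum_ite_eq', Finset.mem_univ, if_true]
    · exact Finset.sum_eq_zero fun a _ => if_neg fun ha => h ⟨a, ha⟩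
  simp only [map_sum, epsCoord_wt, Finset.sum_sub_distrib, hcount]

/-- The basis vectors with indices `ρ a` span an isotropic subspace: no two of these indices are
interchanged by `bar`. -/
def IsIsotropic {ι : Type*} (ρ : ι → J n) : Prop := ∀ a b, ρ a ≠ bar (ρ b)

theorem isIsotropic_emb {k : ℕ} (hk : k ≤ n) : IsIsotropic (emb hk) := fun _ _ => Sum.inl_ne_inr

theorem IsIsotropic.wordPerm_comp {ι : Type*} {ρ : ι → J n} (h : IsIsotropic ρ)
    (l : List (Fin n)) : IsIsotropic (wordPerm l ∘ ρ) := fun a b hab => h a b <| by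
  rwa [Function.comp_apply, Function.comp_apply, ← wordPerm_bar, (wordPerm l).apply_eq_iff_eq]
    at hab

theorem IsIsotropic.inl_notMem_or_inr_notMem_range {ι : Type*} {ρ : ι → J n}
    (h : IsIsotropic ρ) (i : Fin n) : Sum.inl i ∉ Set.range ρ ∨ Sum.inr i ∉ Set.range ρ := by
  by_contra! hmem
  obtain ⟨⟨a, ha⟩, b, hb⟩ := hmem
  exact h a b (by rw [ha, hb, bar_inr])

theorem IsIsotropic.inl_mem_range_iff {ι : Type*} [Fintype ι] {ρ : ι → J n} (h : IsIsotropic ρ)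
    (hρ : ρ.Injective) (i : Fin n) :
    Sum.inl i ∈ Set.range ρ ↔ epsCoord i (∑ a, wt (ρ a)) = 1 := by
  rw [epsCoord_sum_wt hρ]
  have hexcl := h.inl_notMem_or_inr_notMem_range i
  split_ifs <;> simp_all

theorem IsIsotropic.inr_mem_range_iff {ι : Type*} [Fintype ι] {ρ : ι → J n} (h : IsIsotropic ρ)
    (hρ : ρ.Injective) (i : Fin n) :
    Sum.inr i ∈ Set.range ρ ↔ epsCoord i (∑ a, wt (ρ a)) = -1 := by
  rw [epsCoord_sum_wt hρ]
  have hexcl := h.inl_notMem_or_inr_notMem_range i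
  split_ifs <;> simp_all

theorem IsIsotropic.range_eq_of_sum_wt_eq {ι : Type*} [Fintype ι] {ρ ρ' : ι → J n}
    (h : IsIsotropic ρ) (h' : IsIsotropic ρ') (hρ : ρ.Injective) (hρ' : ρ'.Injective)
    (hwt : ∑ a, wt (ρ a) = ∑ a, wt (ρ' a)) : Set.range ρ = Set.range ρ' := by
  ext (i | i)
  · rw [h.inl_mem_range_iff hρ, h'.inl_mem_range_iff hρ', hwt]
  · rw [h.inr_mem_range_iff hρ, h'.inr_mem_range_iff hρ', hwt]

/-- The sign of `ω(v_j, v_{j̄})`. -/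
def formSign : J n → ℂ
  | Sum.inl a => (-1) ^ (a : ℕ)
  | Sum.inr a => -(-1) ^ (a : ℕ)

theorem formSign_mul_self (j : J n) : formSign j * formSign j = 1 := by
  rcases j with a | a <;>
    simp only [formSign, neg_mul_neg, ← mul_pow, one_pow, mul_one]

theorem Ω_apply (r t : J n) : Ω n r t = if t = bar r then formSign r else 0 := by
  rcases r with a | a <;> rcases t with b | b <;> simp [Ω, formSign, bar, eq_comm]

theorem formSign_bar (j : J n) : formSign (bar j) = -formSign j := by
  rcases j with a | a <;> simp only [bar, Sum.swap_inl, Sum.swap_inr, formSign, neg_neg]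

theorem Ω_mul_apply (M : Matrix (J n) (J n) ℂ) (r t : J n) :
    (Ω n * M) r t = formSign r * M (bar r) t := by
  simp only [Matrix.mul_apply, Ω_apply, ite_mul, zero_mul, Finset.sum_ite_eq', Finset.mem_univ,
    if_true]

theorem mul_Ω_apply (M : Matrix (J n) (J n) ℂ) (r t : J n) :
    (M * Ω n) r t = -(M r (bar t) * formSign t) := by
  have hbar (j : J n) : t = bar j ↔ j = bar t := by
    rw [← bar_injective.eq_iff, bar_bar, eq_comm]
  simp only [Matrix.mul_apply, Ω_apply, hbar, mul_ite, mul_zero, Finset.sum_ite_eq',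
    Finset.mem_univ, if_true, formSign_bar, mul_neg]

theorem Ω_mul_Ω : Ω n * Ω n = -1 := by
  ext r t
  rw [Ω_mul_apply, Ω_apply, bar_bar, formSign_bar, Matrix.neg_apply, Matrix.one_apply]
  rcases eq_or_ne t r with rfl | htr
  · rw [if_pos rfl, if_pos rfl, mul_neg, formSign_mul_self]
  · rw [if_neg htr, if_neg htr.symm, mul_zero, neg_zero]

/-- The adjoint of a matrix with respect to the symplectic form. -/
def adj (M : Matrix (J n) (J n) ℂ) : Matrix (J n) (J n) ℂ := -(Ω n * Mᵀ * Ω n)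

theorem adj_apply (M : Matrix (J n) (J n) ℂ) (r t : J n) :
    adj M r t = formSign r * formSign t * M (bar t) (bar r) := by
  rw [adj, Matrix.neg_apply, mul_Ω_apply, Ω_mul_apply, Matrix.transpose_apply, neg_neg]
  ring

theorem adj_apply_self (M : Matrix (J n) (J n) ℂ) (r : J n) :
    adj M r r = M (bar r) (bar r) := by
  rw [adj_apply, formSign_mul_self, one_mul]

theorem adj_mul (A B : Matrix (J n) (J n) ℂ) : adj (A * B) = adj B * adj A := by
  have hassoc : adj B * adj A = Ω n * Bᵀ * (Ω n * Ω n) * Aᵀ * Ω n := by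
    simp only [adj, neg_mul_neg, mul_assoc]
  rw [hassoc, Ω_mul_Ω, adj, Matrix.transpose_mul]
  simp only [mul_neg, neg_mul, mul_one, mul_assoc]

theorem adj_one : adj (1 : Matrix (J n) (J n) ℂ) = 1 := by
  rw [adj, Matrix.transpose_one, mul_one, Ω_mul_Ω, neg_neg]

theorem adj_mul_self (M : Matrix (J n) (J n) ℂ) : adj M * M = -(Ω n * (Mᵀ * Ω n * M)) := by
  simp only [adj, neg_mul, mul_assoc]

theorem adj_mul_mat (g : G n) : adj (mat g) * mat g = 1 := by
  have hg : (mat g)ᵀ * Ω n * mat g = Ω n := g.2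
  rw [adj_mul_self, hg, Ω_mul_Ω, neg_neg]

theorem exists_mat_eq {M : Matrix (J n) (J n) ℂ} (h : adj M * M = 1) : ∃ g : G n, mat g = M := by
  refine ⟨⟨⟨M, adj M, mul_eq_one_comm.mp h, h⟩, ?_⟩, rfl⟩
  change Mᵀ * Ω n * M = Ω n
  calc Mᵀ * Ω n * M = -(Ω n * Ω n) * (Mᵀ * Ω n * M) := by rw [Ω_mul_Ω, neg_neg, one_mul]
    _ = Ω n * (adj M * M) := by rw [adj_mul_self, mul_neg, neg_mul, mul_assoc]
    _ = Ω n := by rw [h, mul_one]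

theorem blockTriangular_adj {α : Type*} [LT α] {b : J n → α}
    (hb : ∀ r t, b t < b r → b (bar r) < b (bar t)) {M : Matrix (J n) (J n) ℂ}
    (hM : M.BlockTriangular b) : (adj M).BlockTriangular b := fun r t h => by
  rw [adj_apply, hM (hb r t h), mul_zero]

theorem rank_bar_lt_of_rank_lt (r t : J n) (h : rank t < rank r) :
    rank (bar r) < rank (bar t) := rank_bar_lt_rank_bar.mpr h

open OrderDual in
theorem adj_mul_self_eq_one_of_lower_mul_upper {K P : Matrix (J n) (J n) ℂ}
    (hK : K.BlockTriangular (toDual ∘ rank)) (hK_diag : ∀ r, K r r = 1)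
    (hP : P.BlockTriangular rank) (h : adj (K * P) * (K * P) = 1) : adj K * K = 1 := by
  rw [adj_mul, ← mul_assoc] at h
  have hP_det : IsUnit P.det := Matrix.isUnit_det_of_left_inverse h
  have hPP : P * P⁻¹ = 1 := Matrix.mul_nonsing_inv P hP_det
  have hP_inv : P⁻¹.BlockTriangular rank := by
    let _ := Matrix.invertibleOfIsUnitDet P hP_det
    exact Matrix.blockTriangular_inv_of_blockTriangular hP
  have hK_adj : (adj K).BlockTriangular (toDual ∘ rank) :=
    blockTriangular_adj (fun r t => rank_bar_lt_of_rank_lt t r) hK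
  have hupper : adj K * K = adj P⁻¹ * P⁻¹ := by
    have hadj : adj P⁻¹ * adj P = 1 := by rw [← adj_mul, hPP, adj_one]
    calc adj K * K = adj P⁻¹ * adj P * (adj K * K) * (P * P⁻¹) := by
          rw [hadj, hPP, one_mul, mul_one]
      _ = adj P⁻¹ * (adj P * adj K * K * P) * P⁻¹ := by simp only [mul_assoc]
      _ = adj P⁻¹ * P⁻¹ := by rw [h, mul_one]
  refine eq_one_of_blockTriangular rank_injective ?_ (hK_adj.mul hK) fun r => ?_
  · rw [hupper]
    exact (blockTriangular_adj rank_bar_lt_of_rank_lt hP_inv).mul hP_inv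
  · rw [blockTriangular_mul_apply_self (toDual.injective.comp rank_injective) hK_adj hK,
      adj_apply_self, hK_diag, hK_diag, one_mul]

theorem mat_torus (a : Fin n → ℂˣ) :
    mat (torus a) = Matrix.diagonal fun j => (character (wt j) a : ℂ) := rfl

theorem character_prod_Iic (lam : Weight n) (d : Fin n → ℂˣ) :
    character lam (fun i => ∏ k ∈ Finset.Iic i, d k) = ∏ k, d k ^ epsCoord k lam := by
  simp only [character, ← Finset.prod_zpow]
  rw [Finset.prod_comm' (t' := Finset.univ) (s' := Finset.Ici) (by simp)]
  refine Finset.prod_congr rfl fun k _ => ?_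
  rw [epsCoord, LinearMap.sum_apply]
  exact (map_sum (zpowersHom ℂˣ (d k)).toAdditiveRight lam _).symm

theorem exists_torus {d : J n → ℂ} (hd : ∀ j, d (bar j) * d j = 1) :
    ∃ a : Fin n → ℂˣ, mat (torus a) = Matrix.diagonal d := by
  let D : Fin n → ℂˣ := fun i =>
    ⟨d (Sum.inl i), d (Sum.inr i), hd (Sum.inr i), hd (Sum.inl i)⟩
  refine ⟨fun i => ∏ k ∈ Finset.Iic i, D k, ?_⟩
  rw [mat_torus]
  congr 1
  ext1 j
  rw [character_prod_Iic]
  rcases j with i | i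
  · simp only [epsCoord_wt_inl, pow_ite, zpow_one, zpow_zero, Finset.prod_ite_eq',
      Finset.mem_univ, if_true]
    rfl
  · simp only [epsCoord_wt_inr, pow_ite, zpow_neg_one, zpow_zero, Finset.prod_ite_eq',
      Finset.mem_univ, if_true]
    rfl

theorem exists_eq_torus_mul_upperUnipotent {g : G n} (hg : (mat g).BlockTriangular rank) :
    ∃ a v, IsUpperUnipotent v ∧ g = torus a * v := by
  have hd : ∀ j, mat g (bar j) (bar j) * mat g j j = 1 := fun j => by
    have hdiag := blockTriangular_mul_apply_self rank_injective
      (blockTriangular_adj rank_bar_lt_of_rank_lt hg) hg j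
    rwa [adj_mul_mat, Matrix.one_apply_eq, adj_apply_self, eq_comm] at hdiag
  have hd_ne (j : J n) : mat g j j ≠ 0 := right_ne_zero_of_mul_eq_one (hd j)
  obtain ⟨a, ha⟩ := exists_torus (d := fun j => mat g j j) hd
  have hg_apply (r t : J n) : mat g r t = mat g r r * mat ((torus a)⁻¹ * g) r t := by
    conv_lhs => rw [← mul_inv_cancel_left (torus a) g, mat_mul, ha, Matrix.diagonal_mul]
  refine ⟨a, (torus a)⁻¹ * g, ⟨fun r => ?_, fun r t h => ?_⟩, (mul_inv_cancel_left _ _).symm⟩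
  · exact (mul_right_eq_self₀.mp (hg_apply r r).symm).resolve_right (hd_ne r)
  · exact (mul_eq_zero.mp ((hg_apply r t).symm.trans (hg h))).resolve_left (hd_ne r)

theorem exists_eq_lower_mul_torus_mul_upper {g : G n}
    (hg : ∀ r : J n, ((mat g).toSquareBlockProp fun t => rank t < rank r).det ≠ 0) :
    ∃ u a v, IsLowerUnipotent u ∧ IsUpperUnipotent v ∧ g = u * torus a * v := by
  obtain ⟨K, P, hK, hK_diag, hP, hKP⟩ :=
    exists_eq_lower_mul_upper rank_injective (mat g) fun r => (hg r).isUnit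
  have hKK : adj K * K = 1 :=
    adj_mul_self_eq_one_of_lower_mul_upper hK hK_diag hP (by rw [← hKP, adj_mul_mat])
  obtain ⟨u, rfl⟩ := exists_mat_eq hKK
  have hP_eq : mat (u⁻¹ * g) = P := by
    rw [mat_mul, hKP, ← mul_assoc, ← mat_mul, inv_mul_cancel, mat_one, one_mul]
  obtain ⟨a, v, hv, hav⟩ := exists_eq_torus_mul_upperUnipotent (g := u⁻¹ * g) (by rwa [hP_eq])
  exact ⟨u, a, v, ⟨hK_diag, fun r t h => hK h⟩, hv, by rw [mul_assoc, ← hav, mul_inv_cancel_left]⟩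

theorem mat_inv (g : G n) : mat g⁻¹ = adj (mat g) := by
  have hinv : mat g * mat g⁻¹ = 1 := by rw [← mat_mul, mul_inv_cancel, mat_one]
  rw [← one_mul (mat g⁻¹), ← adj_mul_mat g, mul_assoc, hinv, mul_one]

theorem character_mul (lam : Weight n) (a b : Fin n → ℂˣ) :
    character lam (a * b) = character lam a * character lam b := by
  simp only [character, Pi.mul_apply, mul_zpow, Finset.prod_mul_distrib]

theorem torus_mul (a b : Fin n → ℂˣ) : torus (a * b) = torus a * torus b :=
  mat_injective <| by
    simp only [mat_mul, mat_torus, Matrix.diagonal_mul_diagonal, character_mul, Units.val_mul]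

/-- The parametrization of the maximal torus, as a group homomorphism. -/
def torusHom (n : ℕ) : (Fin n → ℂˣ) →* G n := MonoidHom.mk' torus torus_mul

/-- The elements that some polynomial curve joins to the maximal torus. -/
def joinedToTorus (n : ℕ) : Subgroup (G n) where
  carrier := {g | ∃ (γ : ℂ → G n) (p : Matrix (J n) (J n) (Polynomial ℂ)),
    (∀ z, mat (γ z) = p.map (Polynomial.eval z)) ∧ γ 0 ∈ (torusHom n).range ∧ γ 1 = g}
  one_mem' := ⟨1, 1, fun z => by ext r t; simp [Matrix.one_apply, apply_ite], one_mem _, rfl⟩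
  mul_mem' := by
    rintro _ _ ⟨γ, p, hp, hγ, rfl⟩ ⟨δ, q, hq, hδ, rfl⟩
    refine ⟨γ * δ, p * q, fun z => ?_, mul_mem hγ hδ, rfl⟩
    rw [Pi.mul_apply, mat_mul, hp, hq]
    exact (Matrix.map_mul (f := Polynomial.evalRingHom z)).symm
  inv_mem' := by
    rintro _ ⟨γ, p, hp, hγ, rfl⟩
    refine ⟨γ⁻¹, Matrix.of fun r t => Polynomial.C (formSign r * formSign t) * p (bar t) (bar r),
      fun z => ?_, inv_mem hγ, rfl⟩
    ext r t
    rw [Pi.inv_apply, mat_inv, adj_apply, hp, Matrix.map_apply, Matrix.map_apply, Matrix.of_apply,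
      Polynomial.eval_mul, Polynomial.eval_C]

theorem torus_mem_joinedToTorus (a : Fin n → ℂˣ) : torus a ∈ joinedToTorus n :=
  ⟨fun _ => torus a, (mat (torus a)).map Polynomial.C, fun z => by ext r t; simp, ⟨a, rfl⟩, rfl⟩

theorem mem_joinedToTorus_of_mat_eq {g : ℂ → G n} {A : Matrix (J n) (J n) ℂ}
    (hg : ∀ a, mat (g a) = 1 + a • A) (a : ℂ) : g a ∈ joinedToTorus n := by
  refine ⟨fun z => g (z * a), 1 + (Polynomial.X * Polynomial.C a) • A.map Polynomial.C,
    fun z => ?_, ?_, congrArg g (one_mul a)⟩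
  · ext r t
    simp [hg, Matrix.one_apply, apply_ite (Polynomial.eval z), mul_comm a]
  · have hg_zero : g 0 = 1 := mat_injective (by rw [hg, zero_smul, add_zero, mat_one])
    change g (0 * a) ∈ _
    rw [zero_mul, hg_zero]
    exact one_mem _

theorem y_mem_joinedToTorus (i : Fin n) (a : ℂ) : y i a ∈ joinedToTorus n :=
  mem_joinedToTorus_of_mat_eq (mat_y i) a

theorem sBar_mem_joinedToTorus (i : Fin n) : sBar i ∈ joinedToTorus n :=
  have hx (a : ℂ) : x i a ∈ joinedToTorus n := mem_joinedToTorus_of_mat_eq (mat_x i) a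
  mul_mem (mul_mem (hx _) (y_mem_joinedToTorus i _)) (hx _)

theorem prod_sBar_mem_joinedToTorus (l : List (Fin n)) :
    (l.map sBar).prod ∈ joinedToTorus n :=
  list_prod_mem (List.forall_mem_map.mpr fun i _ => sBar_mem_joinedToTorus i)

theorem Θ_mem_joinedToTorus (c : Fin n → Fin n → ℂˣ) : Θ c ∈ joinedToTorus n :=
  list_prod_mem <| List.forall_mem_ofFn_iff.mpr fun _ =>
    list_prod_mem <| List.forall_mem_ofFn_iff.mpr fun _ =>
      mul_mem (y_mem_joinedToTorus _ _) (torus_mem_joinedToTorus _)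

theorem IsRegular.exists_polynomial {F : G n → ℂ} (hF : IsRegular F) {γ : ℂ → G n}
    {p : Matrix (J n) (J n) (Polynomial ℂ)} (hp : ∀ z, mat (γ z) = p.map (Polynomial.eval z)) :
    ∃ P : Polynomial ℂ, ∀ z, F (γ z) = P.eval z := by
  obtain ⟨q, hq⟩ := hF
  refine ⟨MvPolynomial.aeval (fun k => p k.1 k.2) q, fun z => ?_⟩
  rw [hq, hp, ← Polynomial.coe_evalRingHom, MvPolynomial.aeval_def, MvPolynomial.eval₂_comp_left]
  have hcomp : (Polynomial.evalRingHom z).comp (algebraMap ℂ (Polynomial ℂ)) = RingHom.id ℂ := by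
    ext; simp
  rw [hcomp]
  rfl

/-- The product of the leading principal minors of sizes `0, …, 2n - 1`. It does not vanish on an
element of the group if and only if this element lies in the big cell `U⁻ T U`. -/
def leadingMinorProd {R : Type*} [CommRing R] (M : Matrix (J n) (J n) R) : R :=
  ∏ r : J n, (M.toSquareBlockProp fun t => rank t < rank r).det

theorem leadingMinorProd_map {R S : Type*} [CommRing R] [CommRing S] (φ : R →+* S)
    (M : Matrix (J n) (J n) R) : leadingMinorProd (M.map φ) = φ (leadingMinorProd M) := by
  rw [leadingMinorProd, leadingMinorProd, map_prod]
  refine Finset.prod_congr rfl fun r _ => ?_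
  rw [RingHom.map_det]
  rfl

theorem leadingMinorProd_torus_ne_zero (a : Fin n → ℂˣ) :
    leadingMinorProd (mat (torus a)) ≠ 0 := by
  refine Finset.prod_ne_zero_iff.mpr fun r _ => ?_
  rw [mat_torus, Matrix.toSquareBlockProp_def]
  change (Matrix.submatrix _ Subtype.val Subtype.val).det ≠ 0
  rw [Matrix.submatrix_diagonal _ _ Subtype.val_injective, Matrix.det_diagonal]
  exact Finset.prod_ne_zero_iff.mpr fun t _ => Units.ne_zero _

theorem IsPrincipalMinor.eq_of_leadingMinorProd_ne_zero {mu : Weight n} {F F' : G n → ℂ}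
    (hF : IsPrincipalMinor mu F) (hF' : IsPrincipalMinor mu F') {g : G n}
    (hg : leadingMinorProd (mat g) ≠ 0) : F g = F' g := by
  obtain ⟨u, a, v, hu, hv, rfl⟩ := exists_eq_lower_mul_torus_mul_upper fun r =>
    Finset.prod_ne_zero_iff.mp hg r (Finset.mem_univ r)
  rw [hF.2 u v a hu hv, hF'.2 u v a hu hv]

theorem polynomial_eq_of_eval_eq_of_eval_ne_zero {R : Type*} [CommRing R] [IsDomain R] [Infinite R]
    {P P' B : Polynomial R} (hB : B ≠ 0) (h : ∀ z, B.eval z ≠ 0 → P.eval z = P'.eval z) :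
    P = P' := by
  have hmul : (P - P') * B = 0 := Polynomial.funext fun z => by
    rw [Polynomial.eval_mul, Polynomial.eval_zero, Polynomial.eval_sub, mul_eq_zero, sub_eq_zero]
    exact or_iff_not_imp_right.mpr (h z)
  exact sub_eq_zero.mp ((mul_eq_zero.mp hmul).resolve_right hB)

theorem IsPrincipalMinor.eq_of_mem_joinedToTorus {mu : Weight n} {F F' : G n → ℂ}
    (hF : IsPrincipalMinor mu F) (hF' : IsPrincipalMinor mu F') {g : G n}
    (hg : g ∈ joinedToTorus n) : F g = F' g := by
  obtain ⟨γ, p, hp, ⟨a, ha⟩, rfl⟩ := hg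
  obtain ⟨P, hP⟩ := hF.1.exists_polynomial hp
  obtain ⟨P', hP'⟩ := hF'.1.exists_polynomial hp
  have hB (z : ℂ) : (leadingMinorProd p).eval z = leadingMinorProd (mat (γ z)) := by
    rw [hp]
    exact (leadingMinorProd_map (Polynomial.evalRingHom z) p).symm
  have hB_ne : leadingMinorProd p ≠ 0 := fun h => leadingMinorProd_torus_ne_zero a <| by
    rw [← Polynomial.eval_zero (x := 0), ← h, hB, ← ha]
    rfl
  have hPP' : P = P' := polynomial_eq_of_eval_eq_of_eval_ne_zero hB_ne fun z hz => by
    rw [hB] at hz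
    rw [← hP, ← hP', hF.eq_of_leadingMinorProd_ne_zero hF' hz]
  rw [hP, hP', hPP']

theorem sum_eq_sum_emb {M : Type*} [AddCommMonoid M] {k : ℕ} (hk : k ≤ n) {F : J n → M}
    (h : ∀ j, k ≤ rank j → F j = 0) : ∑ j, F j = ∑ a, F (emb hk a) := by
  refine (Fintype.sum_of_injective (emb hk) (emb_injective hk) _ F (fun j hj => h j ?_)
    fun _ => rfl).symm
  by_contra! hlt
  exact hj ⟨⟨rank j, hlt⟩, rank_injective rfl⟩

theorem submatrix_emb_mul_of_isUpperUnipotent {k : ℕ} (hk : k ≤ n) {v : G n}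
    (hv : IsUpperUnipotent v) (M : Matrix (J n) (J n) ℂ) :
    (M * mat v).submatrix (emb hk) (emb hk) =
      M.submatrix (emb hk) (emb hk) * (mat v).submatrix (emb hk) (emb hk) := by
  ext a b
  rw [Matrix.submatrix_apply, Matrix.mul_apply, sum_eq_sum_emb hk, Matrix.mul_apply]
  · rfl
  · intro j hj
    rw [hv.2 j _ ((rank_emb hk b).trans_lt (b.2.trans_le hj)), mul_zero]

theorem IsLowerUnipotent.leadingMinor_eq_one {k : ℕ} (hk : k ≤ n) {u : G n}
    (hu : IsLowerUnipotent u) : leadingMinor hk (mat u) = 1 := by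
  rw [leadingMinor, Matrix.det_of_isLowerTriangular ((mat u).submatrix (emb hk) (emb hk))
    fun a b h => hu.2 _ _ h]
  exact Finset.prod_eq_one fun a _ => hu.1 _

theorem IsUpperUnipotent.leadingMinor_eq_one {k : ℕ} (hk : k ≤ n) {v : G n}
    (hv : IsUpperUnipotent v) : leadingMinor hk (mat v) = 1 := by
  rw [leadingMinor, Matrix.det_of_isUpperTriangular (M := (mat v).submatrix (emb hk) (emb hk))
    fun a b h => hv.2 _ _ h]
  exact Finset.prod_eq_one fun a _ => hv.1 _

theorem character_sum {ι : Type*} (S : Finset ι) (lam : ι → Weight n) (a : Fin n → ℂˣ) :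
    character (∑ i ∈ S, lam i) a = ∏ i ∈ S, character (lam i) a := by
  simp only [character, Finset.sum_apply]
  rw [Finset.prod_comm]
  exact Finset.prod_congr rfl fun k _ =>
    map_sum (zpowersHom ℂˣ (a k)).toAdditiveRight (fun i => lam i k) S

theorem isRegular_leadingMinor {k : ℕ} (hk : k ≤ n) :
    IsRegular fun g : G n => leadingMinor hk (mat g) := by
  refine ⟨(Matrix.of fun a b => MvPolynomial.X (emb hk a, emb hk b)).det, fun g => ?_⟩
  rw [RingHom.map_det]
  refine congrArg Matrix.det ?_
  ext a b
  simp

theorem isPrincipalMinor_leadingMinor {k : ℕ} (hk : 1 ≤ k) (hkn : k ≤ n) :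
    IsPrincipalMinor (fundWeight (node n k hk hkn)) fun g => leadingMinor hkn (mat g) := by
  refine ⟨isRegular_leadingMinor hkn, fun u v a hu hv => ?_⟩
  have hsplit : (mat (u * torus a * v)).submatrix (emb hkn) (emb hkn) =
      (mat u).submatrix (emb hkn) (emb hkn) *
        Matrix.diagonal (fun b => (character (wt (emb hkn b)) a : ℂ)) *
        (mat v).submatrix (emb hkn) (emb hkn) := by
    rw [mat_mul, submatrix_emb_mul_of_isUpperUnipotent hkn hv]
    congr 1
    ext b c
    rw [mat_mul, mat_torus, Matrix.submatrix_apply, Matrix.mul_diagonal, Matrix.mul_diagonal]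
    rfl
  simp only [leadingMinor]
  rw [hsplit, Matrix.det_mul, Matrix.det_mul, Matrix.det_diagonal]
  change leadingMinor hkn (mat u) * _ * leadingMinor hkn (mat v) = _
  rw [hu.leadingMinor_eq_one, hv.leadingMinor_eq_one, one_mul, mul_one,
    fundWeight_node_eq_sum, character_sum, Units.coe_prod]

theorem principalMinor_fundWeight {k : ℕ} (hk : 1 ≤ k) (hkn : k ≤ n) {g : G n}
    (hg : g ∈ joinedToTorus n) :
    principalMinor (fundWeight (node n k hk hkn)) g = leadingMinor hkn (mat g) :=
  have hspec : IsPrincipalMinor _ (principalMinor (fundWeight (node n k hk hkn))) :=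
    Classical.epsilon_spec ⟨_, isPrincipalMinor_leadingMinor hk hkn⟩
  hspec.eq_of_mem_joinedToTorus (isPrincipalMinor_leadingMinor hk hkn) hg

theorem exists_generalizedMinor_eq {mu gam del : Weight n}
    (hgam : ∃ w : weylGroup n, (w : Weight n ≃ₗ[ℤ] Weight n) mu = gam)
    (hdel : ∃ w : weylGroup n, (w : Weight n ≃ₗ[ℤ] Weight n) mu = del) (g : G n) :
    ∃ (u v : weylGroup n) (l l' : List (Fin n)),
      (u : Weight n ≃ₗ[ℤ] Weight n) mu = gam ∧ (v : Weight n ≃ₗ[ℤ] Weight n) mu = del ∧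
      IsReducedWord l u ∧ IsReducedWord l' v ∧
      generalizedMinor mu gam del g =
        principalMinor mu ((l.map sBar).prod⁻¹ * g * (l'.map sBar).prod) :=
  ⟨_, _, _, _, Classical.epsilon_spec hgam, Classical.epsilon_spec hdel,
    Classical.epsilon_spec (exists_isReducedWord _),
    Classical.epsilon_spec (exists_isReducedWord _), rfl⟩

theorem IsReducedWord.sum_wt_wordPerm_emb {k : ℕ} (hk : 1 ≤ k) (hkn : k ≤ n) {l : List (Fin n)}
    {w : weylGroup n} (hl : IsReducedWord l w) :
    ∑ a, wt ((wordPerm l ∘ emb hkn) a) =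
      (w : Weight n ≃ₗ[ℤ] Weight n) (fundWeight (node n k hk hkn)) := by
  rw [fundWeight_node_eq_sum, map_sum, ← hl.1]
  exact Finset.sum_congr rfl fun a _ => wt_wordPerm l _

theorem generalizedMinor_fundWeight {k : ℕ} (hk : 1 ≤ k) (hkn : k ≤ n) {gam del : Weight n}
    (hgam : ∃ w : weylGroup n, (w : Weight n ≃ₗ[ℤ] Weight n) (fundWeight (node n k hk hkn)) = gam)
    (hdel : ∃ w : weylGroup n, (w : Weight n ≃ₗ[ℤ] Weight n) (fundWeight (node n k hk hkn)) = del)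
    {ρ σ : Fin k → J n} (hρ : ρ.Injective) (hσ : σ.Injective) (hρ' : IsIsotropic ρ)
    (hσ' : IsIsotropic σ) (hρ_wt : ∑ a, wt (ρ a) = gam) (hσ_wt : ∑ a, wt (σ a) = del)
    {g : G n} (hg : g ∈ joinedToTorus n) :
    generalizedMinor (fundWeight (node n k hk hkn)) gam del g =
      inversionSign ℂ (rank ∘ ρ) *
        (inversionSign ℂ (rank ∘ σ) * ((mat g).submatrix ρ σ).det) := by
  obtain ⟨u, v, l, l', hu, hv, hl, hl', heq⟩ := exists_generalizedMinor_eq hgam hdel g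
  have hinj (l : List (Fin n)) : (wordPerm l ∘ emb hkn).Injective :=
    (wordPerm l).injective.comp (emb_injective hkn)
  have hiso (l : List (Fin n)) := (isIsotropic_emb hkn).wordPerm_comp l
  have hrows : Set.range ρ = Set.range (wordPerm l ∘ emb hkn) :=
    hρ'.range_eq_of_sum_wt_eq (hiso l) hρ (hinj l) <| by
      rw [hρ_wt, hl.sum_wt_wordPerm_emb hk hkn, hu]
  have hcols : Set.range σ = Set.range (wordPerm l' ∘ emb hkn) :=
    hσ'.range_eq_of_sum_wt_eq (hiso l') hσ (hinj l') <| by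
      rw [hσ_wt, hl'.sum_wt_wordPerm_emb hk hkn, hv]
  have hmem := mul_mem (mul_mem (inv_mem (prod_sBar_mem_joinedToTorus l)) hg)
    (prod_sBar_mem_joinedToTorus l')
  rw [heq, principalMinor_fundWeight hk hkn hmem, leadingMinor_conj hkn hl hl',
    inversionSign_mul_det_cols rank_injective _ _ hσ (hinj l') hcols, mul_left_comm,
    inversionSign_mul_det_rows rank_injective _ _ hρ (hinj l) hrows, mul_left_comm]

/-! ### The matrix of the parametrization -/

theorem character_mulSingle (lam : Weight n) (i : Fin n) (a : ℂˣ) :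
    character lam (Pi.mulSingle i a) = a ^ lam i := by
  rw [character, Finset.prod_eq_single i, Pi.mulSingle_eq_same]
  · intro k _ hk
    rw [Pi.mulSingle_eq_of_ne hk, one_zpow]
  · exact fun h => absurd (Finset.mem_univ i) h

theorem mul_f_apply (W : Matrix (J n) (J n) ℂ) (i : Fin n) (r t : J n) :
    (W * f i) r t = if Raises i (reflPerm i t) then W r (reflPerm i t) else 0 := by
  simp only [Matrix.mul_apply, f_apply, ite_and, mul_ite, mul_one, mul_zero]
  split_ifs <;> simp

theorem mul_mat_bigY_apply (i : Fin n) (a : ℂˣ) (W : Matrix (J n) (J n) ℂ) (r t : J n) :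
    (W * mat (bigY i a)) r t =
      (W r t + if Raises i (reflPerm i t) then a * W r (reflPerm i t) else 0) *
        (a : ℂ) ^ (-wt t i) := by
  rw [bigY, mat_mul, mat_y, coroot, mat_torus, ← mul_assoc, Matrix.mul_diagonal, mul_add, mul_one,
    Matrix.mul_smul, Matrix.add_apply, Matrix.smul_apply, mul_f_apply, character_mulSingle,
    inv_zpow', Units.val_zpow_eq_zpow_val, smul_eq_mul, mul_ite, mul_zero]

theorem mul_mat_bigY_inl (i : Fin n) (a : ℂˣ) (W : Matrix (J n) (J n) ℂ) (r : J n) (b : Fin n) :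
    (W * mat (bigY i a)) r (Sum.inl b) =
      if b = i then W r (Sum.inl i) / a + W r (up i)
      else if (b : ℕ) = i + 1 then a * W r (Sum.inl b) else W r (Sum.inl b) := by
  have hraises : Raises i (reflPerm i (Sum.inl b)) ↔ b = i := by
    rw [raises_reflPerm_iff, ← rank_injective.eq_iff, ← rank_injective.eq_iff, rank_bar, rank_up,
      rank_inl, rank_inl, Fin.ext_iff]
    omega
  simp only [mul_mat_bigY_apply, hraises, wt_inl_apply, eq_comm (a := i), Fin.ext_iff,
    eq_comm (a := (i : ℕ) + 1)]
  split_ifs with hb hb' hb' <;> try omega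
  · obtain rfl : b = i := Fin.ext hb
    rw [reflPerm_inl]
    simp
    field_simp
  · simp [mul_comm]
  · simp

theorem mul_mat_bigY_inr (i : Fin n) (a : ℂˣ) (W : Matrix (J n) (J n) ℂ) (r : J n) (b : Fin n) :
    (W * mat (bigY i a)) r (Sum.inr b) =
      if b = i then a * W r (Sum.inr b)
      else if (b : ℕ) = i + 1 then W r (Sum.inr b) / a + W r (Sum.inr i) else W r (Sum.inr b) := by
  have hup : Sum.inr b = bar (up i) ↔ (b : ℕ) = i + 1 := by
    rw [← rank_injective.eq_iff, rank_bar, rank_up, rank_inr]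
    omega
  have hwt : wt (Sum.inr b) i = -wt (Sum.inl b) i := congrFun (wt_bar (Sum.inl b)) i
  simp only [mul_mat_bigY_apply, raises_reflPerm_iff, hup, reduceCtorEq, false_or, hwt,
    wt_inl_apply, eq_comm (a := i), Fin.ext_iff, eq_comm (a := (i : ℕ) + 1)]
  split_ifs with hb hb' hb' <;> try omega
  · have hrefl : reflPerm i (Sum.inr b) = Sum.inr i := by
      rw [hup.mpr hb, reflPerm_bar, reflPerm_up, bar_inl]
    rw [hrefl]
    simp
    field_simp
  · simp [mul_comm]
  · simp

/-- The matrix of `𝐲_1(q_1) ⋯ 𝐲_p(q_p)`, where `q_0 = 1`. -/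
def partialStepMatrix (n : ℕ) (q : ℕ → ℂ) (p : ℕ) : Matrix (J n) (J n) ℂ := Matrix.of fun r t =>
  match r, t with
  | Sum.inl a, Sum.inl b =>
    if a = b then (if (b : ℕ) < p then q a / q (a + 1) else if (b : ℕ) = p then q a else 1)
    else if (a : ℕ) = b + 1 ∧ (b : ℕ) < p then 1 else 0
  | Sum.inl _, Sum.inr _ => 0
  | Sum.inr a, Sum.inl b => if (b : ℕ) < p ∧ (b : ℕ) + 1 = n then 1 / q a else 0
  | Sum.inr a, Sum.inr b =>
    if (b : ℕ) < p then (if a ≤ b then q (b + 1) / q a else 0)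
    else if (b : ℕ) = p then (if a ≤ b then 1 / q a else 0)
    else if a = b then 1 else 0

/-- The matrix of `𝐲_1(q_1) ⋯ 𝐲_n(q_n)`, where `q_0 = 1`. -/
def stepMatrix (n : ℕ) (q : ℕ → ℂ) : Matrix (J n) (J n) ℂ := Matrix.of fun r t =>
  match r, t with
  | Sum.inl a, Sum.inl b => if a = b then q a / q (a + 1) else if (a : ℕ) = b + 1 then 1 else 0
  | Sum.inl _, Sum.inr _ => 0
  | Sum.inr a, Sum.inl b => if (b : ℕ) + 1 = n then 1 / q a else 0
  | Sum.inr a, Sum.inr b => if a ≤ b then q (b + 1) / q a else 0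

theorem partialStepMatrix_zero {q : ℕ → ℂ} (hq_zero : q 0 = 1) : partialStepMatrix n q 0 = 1 := by
  ext (a | a) (b | b) <;>
    simp only [partialStepMatrix, Matrix.of_apply, Matrix.one_apply, Sum.inl.injEq, Sum.inr.injEq,
      Fin.ext_iff, Fin.le_def] <;>
    grind

theorem partialStepMatrix_self (q : ℕ → ℂ) : partialStepMatrix n q n = stepMatrix n q := by
  ext (a | a) (b | b) <;> simp [partialStepMatrix, stepMatrix]

theorem partialStepMatrix_mul_mat_bigY_inl {q : ℕ → ℂ} {i : Fin n} {a : ℂˣ}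
    (ha : (a : ℂ) = q (i + 1)) (r : J n) (b : Fin n) :
    (partialStepMatrix n q i * mat (bigY i a)) r (Sum.inl b) =
      partialStepMatrix n q (i + 1) r (Sum.inl b) := by
  have hq := ha ▸ a.ne_zero
  rw [mul_mat_bigY_inl, ha, up]
  rcases r with r | r <;> split_ifs <;>
    simp only [partialStepMatrix, Matrix.of_apply, Fin.ext_iff, Fin.le_def] at * <;> grind

theorem partialStepMatrix_mul_mat_bigY_inr {q : ℕ → ℂ} (hq : ∀ i, q i ≠ 0) {i : Fin n} {a : ℂˣ}
    (ha : (a : ℂ) = q (i + 1)) (r : J n) (b : Fin n) :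
    (partialStepMatrix n q i * mat (bigY i a)) r (Sum.inr b) =
      partialStepMatrix n q (i + 1) r (Sum.inr b) := by
  rw [mul_mat_bigY_inr, ha]
  rcases r with r | r
  · simp [partialStepMatrix]
  · have := hq r
    split_ifs <;> simp only [partialStepMatrix, Matrix.of_apply, Fin.ext_iff, Fin.le_def] at * <;>
      grind

theorem partialStepMatrix_mul_mat_bigY {q : ℕ → ℂ} (hq : ∀ i, q i ≠ 0) {i : Fin n} {a : ℂˣ}
    (ha : (a : ℂ) = q (i + 1)) :
    partialStepMatrix n q i * mat (bigY i a) = partialStepMatrix n q (i + 1) := by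
  ext r (b | b)
  exacts [partialStepMatrix_mul_mat_bigY_inl ha r b, partialStepMatrix_mul_mat_bigY_inr hq ha r b]

theorem mat_prod_bigY {q : ℕ → ℂ} (hq : ∀ i, q i ≠ 0) (hq_zero : q 0 = 1) (d : Fin n → ℂˣ)
    (hd : ∀ i : Fin n, (d i : ℂ) = q (i + 1)) :
    mat (List.ofFn fun i => bigY i (d i)).prod = stepMatrix n q := by
  have hpartial : ∀ p ≤ n, mat ((List.ofFn fun i => bigY i (d i)).take p).prod =
      partialStepMatrix n q p := by
    intro p
    induction p with
    | zero => exact fun _ => by rw [List.take_zero, List.prod_nil, mat_one,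
        partialStepMatrix_zero hq_zero]
    | succ p ih =>
      intro hp
      rw [List.prod_take_succ _ _ (by simpa using hp), mat_mul, ih (by omega), List.getElem_ofFn]
      exact partialStepMatrix_mul_mat_bigY (i := ⟨p, hp⟩) hq (hd _)
  rw [← partialStepMatrix_self, ← hpartial n le_rfl, List.take_of_length_le (by simp)]

theorem coord_ne_zero (c : Fin n → Fin n → ℂˣ) (i j : ℕ) : coord c i j ≠ 0 := by
  rw [coord]
  split_ifs
  exacts [Units.ne_zero _, one_ne_zero]

theorem coord_zero (c : Fin n → Fin n → ℂˣ) (j : ℕ) : coord c 0 j = 1 :=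
  dif_neg fun h => absurd h.1.1 (by norm_num)

/-- The matrix of the product of the factors of `Θ⁻(c)` with upper index greater than `p`. -/
def tailMatrix (c : Fin n → Fin n → ℂˣ) (p : ℕ) : Matrix (J n) (J n) ℂ :=
  mat ((List.ofFn fun j => (List.ofFn fun i => bigY i (c i j)).prod).drop p).prod

theorem tailMatrix_zero (c : Fin n → Fin n → ℂˣ) : tailMatrix c 0 = mat (Θ c) := rfl

theorem tailMatrix_self (c : Fin n → Fin n → ℂˣ) : tailMatrix c n = 1 := by
  rw [tailMatrix, List.drop_of_length_le (by simp), List.prod_nil, mat_one]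

theorem tailMatrix_eq_stepMatrix_mul (c : Fin n → Fin n → ℂˣ) {p : ℕ} (hp : p < n) :
    tailMatrix c p = stepMatrix n (fun i => coord c i (p + 1)) * tailMatrix c (p + 1) := by
  have hcoord (i : Fin n) : (c i ⟨p, hp⟩ : ℂ) = coord c (i + 1) (p + 1) := by
    rw [coord, dif_pos ⟨⟨by omega, by omega⟩, by omega, by omega⟩]
    rfl
  rw [tailMatrix, tailMatrix, List.drop_eq_getElem_cons (by simpa using hp), List.prod_cons,
    mat_mul, List.getElem_ofFn,
    mat_prod_bigY (fun i => coord_ne_zero c i _) (coord_zero c _) _ hcoord]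

/-- The row with one-based index `i` of `tailMatrix c p`. The row of index `0` is `0`, so that the
recursion `tailRow_succ` has no exceptional case. -/
def tailRow (c : Fin n → Fin n → ℂˣ) (p i : ℕ) : J n → ℂ :=
  if h : 1 ≤ i ∧ i ≤ n then tailMatrix c p (Sum.inl (node n i h.1 h.2)) else 0

theorem tailRow_zero (c : Fin n → Fin n → ℂˣ) (p : ℕ) : tailRow c p 0 = 0 :=
  dif_neg fun h => absurd h.1 (by norm_num)

theorem tailRow_of_le (c : Fin n → Fin n → ℂˣ) (p : ℕ) {i : ℕ} (hi : 1 ≤ i) (hin : i ≤ n) :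
    tailRow c p i = tailMatrix c p (Sum.inl (node n i hi hin)) := dif_pos ⟨hi, hin⟩

theorem stepMatrix_mul_inl (q : ℕ → ℂ) (M : Matrix (J n) (J n) ℂ) (a : Fin n) (t : J n) :
    (stepMatrix n q * M) (Sum.inl a) t =
      (∑ b : Fin n, if (a : ℕ) = b + 1 then M (Sum.inl b) t else 0) +
        q a / q (a + 1) * M (Sum.inl a) t := by
  have hterm (b : Fin n) : stepMatrix n q (Sum.inl a) (Sum.inl b) * M (Sum.inl b) t =
      (if (a : ℕ) = b + 1 then M (Sum.inl b) t else 0) +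
        if a = b then q a / q (a + 1) * M (Sum.inl b) t else 0 := by
    simp only [stepMatrix, Matrix.of_apply, Fin.ext_iff]
    split_ifs <;> first | omega | simp
  have hinr (b : Fin n) : stepMatrix n q (Sum.inl a) (Sum.inr b) * M (Sum.inr b) t = 0 :=
    zero_mul _
  simp only [Matrix.mul_apply, Fintype.sum_sum_type, hterm, hinr, Finset.sum_add_distrib,
    Finset.sum_ite_eq, Finset.mem_univ, if_true, Finset.sum_const_zero, add_zero]

theorem tailRow_succ (c : Fin n → Fin n → ℂˣ) {p i : ℕ} (hp : p < n) (hi : i < n) (t : J n) :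
    tailRow c p (i + 1) t = tailRow c (p + 1) i t +
      coord c i (p + 1) / coord c (i + 1) (p + 1) * tailRow c (p + 1) (i + 1) t := by
  rw [tailRow_of_le c _ (by omega) hi, tailRow_of_le c _ (by omega) hi,
    tailMatrix_eq_stepMatrix_mul c hp, stepMatrix_mul_inl]
  congr 1
  cases i with
  | zero => simp [tailRow_zero, node]
  | succ i =>
    rw [tailRow_of_le c _ (by omega) hi.le,
      Finset.sum_eq_single (node n (i + 1) (by omega) hi.le), if_pos (by simp [node])]
    · exact fun b _ hb => if_neg fun h => hb (Fin.ext (Nat.succ_injective h.symm))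
    · exact fun h => absurd (Finset.mem_univ _) h

theorem tailRow_inl_of_le (c : Fin n → Fin n → ℂˣ) (b : Fin n) {p i : ℕ} (hp : p ≤ n)
    (hi : i ≤ n) (h : (b : ℕ) + 1 + n ≤ i + p) :
    tailRow c p i (Sum.inl b) = if (b : ℕ) + 1 + n = i + p then 1 else 0 := by
  obtain ⟨m, hm⟩ := Nat.exists_eq_add_of_le hp
  induction m generalizing p i with
  | zero =>
    obtain rfl : n = p := hm
    rw [tailRow_of_le c _ (by omega) hi, tailMatrix_self, Matrix.one_apply]
    refine if_congr ?_ rfl rfl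
    rw [Sum.inl.injEq, Fin.ext_iff]
    simp only [node]
    omega
  | succ m ih =>
    obtain ⟨i, rfl⟩ : ∃ k, i = k + 1 := ⟨i - 1, by omega⟩
    rw [tailRow_succ c (by omega) (by omega), ih (by omega) (by omega) (by omega) (by omega),
      ih (by omega) (by omega) (by omega) (by omega), if_neg (c := _ = i + 1 + (p + 1)) (by omega),
      mul_zero, add_zero]
    exact if_congr (by omega) rfl rfl

/-! ### The lower left block -/

section Entries

variable {𝕜 : Type*} [Field 𝕜]

/-- The coefficients in the expansion of the row `ā` of `Θ⁻(c)` in the last upper rows of the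
partial products, see `tailMatrix_inr_inl`. The entries `q i j` stand for `c_i^{(j)}`. -/
def blockCol (n : ℕ) (q : ℕ → ℕ → 𝕜) : ℕ → ℕ → ℕ → 𝕜
  | 0, p, a => 1 / q a p
  | k + 1, p, a => ∑ b ∈ Finset.Ico a n, q (b + 1) p / q a p * blockCol n q k (p + 1) b

/-- The entries of the lower unitriangular factor of the matrix of the `blockCol`. -/
def lowEntry (q : ℕ → ℕ → 𝕜) : ℕ → ℕ → ℕ → 𝕜
  | 0, p, a => 1 / q a p
  | N + 1, p, a => (∑ b ∈ Finset.range a, q (b + 1) p * lowEntry q N (p + 1) b) / q a p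

/-- The entries, up to sign, of the inverse of the upper unitriangular factor of the matrix of the
`blockCol`. -/
def upEntry (n : ℕ) (q : ℕ → ℕ → 𝕜) : ℕ → ℕ → 𝕜
  | 0, _ => 1
  | N + 1, p => ∑ b ∈ Finset.range n, q (b + 1) p * lowEntry q N (p + 1) b

theorem sum_Ico_div_mul_lowEntry (q : ℕ → ℕ → 𝕜) (N p : ℕ) {a : ℕ} (ha : a ≤ n) :
    ∑ b ∈ Finset.Ico a n, q (b + 1) p / q a p * lowEntry q N (p + 1) b =
      upEntry n q (N + 1) p / q a p - lowEntry q (N + 1) p a := by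
  rw [upEntry, lowEntry, ← Finset.sum_range_add_sum_Ico _ ha, add_div, add_sub_cancel_left,
    Finset.sum_div]
  exact Finset.sum_congr rfl fun b _ => div_mul_eq_mul_div _ _ _

theorem sum_blockCol_mul_upEntry (q : ℕ → ℕ → 𝕜) (N p : ℕ) {a : ℕ} (ha : a ≤ n) :
    ∑ k ∈ Finset.range (N + 1), blockCol n q k p a * ((-1) ^ k * upEntry n q (N - k) (p + k)) =
      lowEntry q N p a := by
  induction N generalizing p a with
  | zero => simp [blockCol, upEntry, lowEntry]
  | succ N ih =>
    have htail : ∑ k ∈ Finset.range (N + 1), blockCol n q (k + 1) p a *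
        ((-1) ^ (k + 1) * upEntry n q (N + 1 - (k + 1)) (p + (k + 1))) =
        -∑ b ∈ Finset.Ico a n, q (b + 1) p / q a p * lowEntry q N (p + 1) b := by
      have hlow : ∀ b ∈ Finset.Ico a n, q (b + 1) p / q a p * lowEntry q N (p + 1) b =
          ∑ k ∈ Finset.range (N + 1), q (b + 1) p / q a p * (blockCol n q k (p + 1) b *
            ((-1) ^ k * upEntry n q (N - k) (p + 1 + k))) := fun b hb => by
        rw [← ih (p + 1) (Finset.mem_Ico.mp hb).2.le, Finset.mul_sum]
      rw [Finset.sum_congr rfl hlow, Finset.sum_comm, ← Finset.sum_neg_distrib]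
      refine Finset.sum_congr rfl fun k _ => ?_
      have hindex : p + (k + 1) = p + 1 + k := by omega
      rw [blockCol, Finset.sum_mul, ← Finset.sum_neg_distrib, Nat.add_sub_add_right, hindex]
      exact Finset.sum_congr rfl fun b _ => by ring
    rw [Finset.sum_range_succ', htail, sum_Ico_div_mul_lowEntry q N p ha, blockCol]
    simp only [pow_zero, Nat.sub_zero, add_zero]
    ring

theorem lowEntry_of_lt (q : ℕ → ℕ → 𝕜) {N a : ℕ} (p : ℕ) (h : a < N) : lowEntry q N p a = 0 := by
  induction N generalizing p a with
  | zero => omega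
  | succ N ih =>
    rw [lowEntry, Finset.sum_eq_zero, zero_div]
    intro b hb
    rw [ih _ ((Finset.mem_range.mp hb).trans_le (Nat.lt_succ_iff.mp h)), mul_zero]

theorem sum_range_mul_lowEntry_of_le (q : ℕ → ℕ → 𝕜) {N a : ℕ} (p : ℕ) (h : a ≤ N) :
    ∑ b ∈ Finset.range a, q (b + 1) p * lowEntry q N (p + 1) b = 0 :=
  Finset.sum_eq_zero fun b hb => by
    rw [lowEntry_of_lt _ _ ((Finset.mem_range.mp hb).trans_le h), mul_zero]

theorem lowEntry_self {q : ℕ → ℕ → 𝕜} (hq : ∀ i j, q i j ≠ 0) (hq_zero : ∀ j, q 0 j = 1)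
    (N p : ℕ) : lowEntry q N p N = 1 := by
  induction N generalizing p with
  | zero => rw [lowEntry, hq_zero, div_one]
  | succ N ih =>
    rw [lowEntry, Finset.sum_range_succ, sum_range_mul_lowEntry_of_le q p le_rfl, ih, zero_add,
      mul_one, div_self (hq _ _)]

theorem lowEntry_succ_self {q : ℕ → ℕ → 𝕜} (hq : ∀ i j, q i j ≠ 0) (hq_zero : ∀ j, q 0 j = 1)
    (N p : ℕ) : lowEntry q N p (N + 1) = 1 / q 1 (p + N) +
      ∑ j ∈ Finset.range N, q (N - j) (p + j) / q (N - j + 1) (p + j) := by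
  induction N generalizing p with
  | zero => simp [lowEntry]
  | succ N ih =>
    have hshift : ∀ j ∈ Finset.range N, q (N + 1 - (j + 1)) (p + (j + 1)) /
        q (N + 1 - (j + 1) + 1) (p + (j + 1)) =
        q (N - j) (p + 1 + j) / q (N - j + 1) (p + 1 + j) := fun j _ => by
      rw [add_right_comm, ← add_assoc p j 1, Nat.add_sub_add_right]
    rw [lowEntry, Finset.sum_range_succ, Finset.sum_range_succ,
      sum_range_mul_lowEntry_of_le q p le_rfl, ih, lowEntry_self hq hq_zero,
      Finset.sum_range_succ' _ N, Finset.sum_congr rfl hshift, add_right_comm p 1 N, ← add_assoc,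
      zero_add, mul_one, add_div, mul_div_cancel_left₀ _ (hq _ _)]
    simp only [Nat.sub_zero, add_zero]
    exact add_comm _ _

end Entries

theorem sum_ite_le_eq_sum_Ico {M : Type*} [AddCommMonoid M] (F : ℕ → M) (a : ℕ) :
    (∑ d : Fin n, if a ≤ d then F d else 0) = ∑ d ∈ Finset.Ico a n, F d := by
  rw [Fin.sum_univ_eq_sum_range (fun d => if a ≤ d then F d else 0), ← Finset.sum_filter]
  refine Finset.sum_congr ?_ fun _ _ => rfl
  ext d
  rw [Finset.mem_filter, Finset.mem_range, Finset.mem_Ico, and_comm]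

theorem stepMatrix_mul_inr (hn : 1 ≤ n) (q : ℕ → ℂ) (M : Matrix (J n) (J n) ℂ) (a : Fin n)
    (t : J n) : (stepMatrix n q * M) (Sum.inr a) t =
      (∑ d : Fin n, if (a : ℕ) ≤ d then q (d + 1) / q a * M (Sum.inr d) t else 0) +
        1 / q a * M (Sum.inl (node n n hn le_rfl)) t := by
  have hinr (d : Fin n) : stepMatrix n q (Sum.inr a) (Sum.inr d) * M (Sum.inr d) t =
      if (a : ℕ) ≤ d then q (d + 1) / q a * M (Sum.inr d) t else 0 := ite_zero_mul _ _ _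
  have hinl (d : Fin n) : stepMatrix n q (Sum.inr a) (Sum.inl d) * M (Sum.inl d) t =
      if d = node n n hn le_rfl then 1 / q a * M (Sum.inl d) t else 0 := by
    refine (ite_zero_mul _ _ _).trans (if_congr ?_ rfl rfl)
    rw [Fin.ext_iff]
    simp only [node]
    omega
  simp only [Matrix.mul_apply, Fintype.sum_sum_type, hinr, hinl, Finset.sum_ite_eq',
    Finset.mem_univ, if_true]
  exact add_comm _ _

theorem tailMatrix_inr_inl (c : Fin n → Fin n → ℂˣ) {p m : ℕ} (hm : p + m = n) (a b : Fin n) :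
    tailMatrix c p (Sum.inr a) (Sum.inl b) = ∑ k ∈ Finset.range m,
      blockCol n (coord c) k (p + 1) a * tailRow c (p + 1 + k) n (Sum.inl b) := by
  induction m generalizing p a with
  | zero =>
    obtain rfl : p = n := hm
    simp [tailMatrix_self]
  | succ m ih =>
    have hn : 1 ≤ n := by omega
    rw [tailMatrix_eq_stepMatrix_mul c (by omega), stepMatrix_mul_inr hn, Finset.sum_range_succ',
      add_zero, tailRow_of_le c _ hn le_rfl, blockCol]
    simp only [ih (p := p + 1) (by omega)]
    rw [sum_ite_le_eq_sum_Ico fun d => coord c (d + 1) (p + 1) / coord c a (p + 1) *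
      ∑ k ∈ Finset.range m,
        blockCol n (coord c) k (p + 1 + 1) d * tailRow c (p + 1 + 1 + k) n (Sum.inl b)]
    simp only [blockCol, Finset.sum_mul, Finset.mul_sum]
    rw [Finset.sum_comm]
    congr 1
    refine Finset.sum_congr rfl fun k _ => Finset.sum_congr rfl fun d _ => ?_
    rw [mul_assoc, add_right_comm _ 1 k, ← add_assoc]

/-! ### Sums over increasing sequences -/

section IncreasingSum

variable {R : Type*} [CommSemiring R]

/-- The sum over all sequences `1 ≤ u_1 < ⋯ < u_m ≤ n` of the products of the `g (u_b) b`, where the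
position `b` is counted from `0`. -/
def increasingSum (g : ℕ → ℕ → R) (n m : ℕ) : R := ∑ u ∈ increasing n m, ∏ b : Fin m, g (u b) b

theorem mem_increasing {m : ℕ} {u : Fin m → ℕ} :
    u ∈ increasing n m ↔ (∀ b, 1 ≤ u b ∧ u b ≤ n) ∧ StrictMono u := by
  simp [increasing]

theorem increasingSum_zero (g : ℕ → ℕ → R) (n : ℕ) : increasingSum g n 0 = 1 := by
  have hunique : increasing n 0 = {Fin.elim0} := by
    ext u
    rw [mem_increasing, Finset.mem_singleton]
    exact ⟨fun _ => Subsingleton.elim _ _, fun _ => ⟨fun b => b.elim0, fun b => b.elim0⟩⟩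
  rw [increasingSum, hunique, Finset.sum_singleton, Finset.univ_eq_empty, Finset.prod_empty]

theorem snoc_mem_increasing {m b : ℕ} (hb : b < n) {u : Fin m → ℕ} (hu : u ∈ increasing b m) :
    (Fin.snoc u (b + 1) : Fin (m + 1) → ℕ) ∈ increasing n (m + 1) := by
  rw [mem_increasing] at hu ⊢
  refine ⟨fun k => ?_, fun k l hkl => ?_⟩
  · induction k using Fin.lastCases with
    | last => rw [Fin.snoc_last]; omega
    | cast k => rw [Fin.snoc_castSucc]; have := hu.1 k; omega
  · obtain ⟨k, rfl⟩ := Fin.eq_castSucc_of_ne_last (hkl.trans_le (Fin.le_last l)).ne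
    rw [Fin.snoc_castSucc]
    induction l using Fin.lastCases with
    | last => rw [Fin.snoc_last]; exact Nat.lt_succ_of_le (hu.1 k).2
    | cast l => rw [Fin.snoc_castSucc]; exact hu.2 hkl

theorem init_mem_increasing {m : ℕ} {u : Fin (m + 1) → ℕ} (hu : u ∈ increasing n (m + 1)) :
    Fin.init u ∈ increasing (u (Fin.last m) - 1) m := by
  rw [mem_increasing] at hu ⊢
  refine ⟨fun k => ⟨(hu.1 _).1, Nat.le_pred_of_lt (hu.2 (Fin.castSucc_lt_last k))⟩,
    hu.2.comp Fin.strictMono_castSucc⟩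

theorem increasingSum_succ (g : ℕ → ℕ → R) (n m : ℕ) : increasingSum g n (m + 1) =
    ∑ b ∈ Finset.range n, g (b + 1) m * increasingSum g b m := by
  simp only [increasingSum, Finset.mul_sum]
  rw [Finset.sum_sigma']
  refine Finset.sum_bij' (fun u _ => ⟨u (Fin.last m) - 1, Fin.init u⟩)
    (fun s _ => Fin.snoc s.2 (s.1 + 1)) (fun u hu => ?_) (fun s hs => ?_) (fun u hu => ?_)
    (fun s _ => ?_) (fun u hu => ?_)
  · have hlast := (mem_increasing.mp hu).1 (Fin.last m)
    exact Finset.mem_sigma.mpr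
      ⟨Finset.mem_range.mpr (by simp only; omega), init_mem_increasing hu⟩
  · rw [Finset.mem_sigma, Finset.mem_range] at hs
    exact snoc_mem_increasing hs.1 hs.2
  · have hlast := (mem_increasing.mp hu).1 (Fin.last m)
    simp only
    rw [Nat.sub_add_cancel hlast.1, Fin.snoc_init_self]
  · simp
  · have hlast := (mem_increasing.mp hu).1 (Fin.last m)
    rw [Fin.prod_univ_castSucc, mul_comm, Nat.sub_add_cancel hlast.1]
    rfl

theorem increasingSum_succ_succ (g : ℕ → ℕ → R) (n m : ℕ) : increasingSum g (n + 1) (m + 1) =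
    increasingSum g n (m + 1) + g (n + 1) m * increasingSum g n m := by
  rw [increasingSum_succ, Finset.sum_range_succ, ← increasingSum_succ]

theorem increasingSum_of_lt (g : ℕ → ℕ → R) {n m : ℕ} (h : n < m) : increasingSum g n m = 0 := by
  induction m generalizing n with
  | zero => omega
  | succ m ih =>
    rw [increasingSum_succ]
    refine Finset.sum_eq_zero fun b hb => ?_
    rw [ih (by rw [Finset.mem_range] at hb; omega), mul_zero]

end IncreasingSum

section Field

variable {𝕜 : Type*} [Field 𝕜]

theorem lowEntry_eq_increasingSum {q g : ℕ → ℕ → 𝕜}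
    (hg : ∀ i b, g (i + 1) b = q (i + 1) (n - (b + 1)) / q i (n - (b + 1) + 1)) {m p : ℕ}
    (hmp : p + m = n) (a : ℕ) : lowEntry q m p a = increasingSum g a m / q a p := by
  induction m generalizing p a with
  | zero => rw [lowEntry, increasingSum_zero]
  | succ m ih =>
    rw [lowEntry, increasingSum_succ]
    congr 1
    refine Finset.sum_congr rfl fun b _ => ?_
    rw [ih (by omega), hg, Nat.sub_eq_of_eq_add hmp.symm, mul_comm_div]

theorem upEntry_eq_increasingSum {q g : ℕ → ℕ → 𝕜}
    (hg : ∀ i b, g (i + 1) b = q (i + 1) (n - (b + 1)) / q i (n - (b + 1) + 1)) {m p : ℕ}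
    (hmp : p + m = n) : upEntry n q m p = increasingSum g n m := by
  cases m with
  | zero => rw [upEntry, increasingSum_zero]
  | succ m =>
    rw [upEntry, increasingSum_succ]
    refine Finset.sum_congr rfl fun b _ => ?_
    rw [lowEntry_eq_increasingSum hg (by omega), hg, Nat.sub_eq_of_eq_add hmp.symm, mul_comm_div]

end Field

theorem sum_increasingSum_mul_tailRow (c : Fin n → Fin n → ℂˣ) {g : ℕ → ℕ → ℂ}
    (hg : ∀ i b, g (i + 1) b = coord c i (n - (i - b)) / coord c (i + 1) (n - (i - b)))
    {i : ℕ} (hi : i ≤ n) (t : J n) :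
    ∑ k ∈ Finset.range (i + 1), (-1) ^ k * increasingSum g i k * tailRow c (n - i + k) i t = 0 := by
  induction i with
  | zero => simp [tailRow_zero]
  | succ i ih =>
    have hsplit (k : ℕ) : (-1 : ℂ) ^ (k + 1) * increasingSum g (i + 1) (k + 1) *
        tailRow c (n - (i + 1) + (k + 1)) (i + 1) t =
        (-1) ^ (k + 1) * increasingSum g i (k + 1) * tailRow c (n - (i + 1) + (k + 1)) (i + 1) t +
        (-1) ^ (k + 1) * g (i + 1) k * increasingSum g i k *
          tailRow c (n - (i + 1) + (k + 1)) (i + 1) t := by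
      rw [increasingSum_succ_succ]
      ring
    have hzero : increasingSum g (i + 1) 0 = increasingSum g i 0 := by
      rw [increasingSum_zero, increasingSum_zero]
    rw [Finset.sum_range_succ', Finset.sum_congr rfl fun k _ => hsplit k, Finset.sum_add_distrib,
      hzero, add_right_comm, ← Finset.sum_range_succ' (fun k => (-1 : ℂ) ^ k * increasingSum g i k *
        tailRow c (n - (i + 1) + k) (i + 1) t), Finset.sum_range_succ,
      increasingSum_of_lt g (Nat.lt_succ_self i), mul_zero, zero_mul, add_zero,
      ← Finset.sum_add_distrib, ← ih (by omega)]
    refine Finset.sum_congr rfl fun k hk => ?_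
    rw [Finset.mem_range] at hk
    rw [tailRow_succ c (p := n - (i + 1) + k) (by omega) (by omega), hg,
      show n - (i + 1) + k + 1 = n - (i - k) by omega,
      show n - (i + 1) + (k + 1) = n - (i - k) by omega, show n - i + k = n - (i - k) by omega]
    ring

/-! ### The evaluation of the minors -/

section Det

variable {R : Type*} [CommRing R] {k : ℕ}

theorem det_sum_range_mul_of_upper (hk : k ≤ n) (v : Fin k → ℕ → R) (d : ℕ → Fin k → R)
    (hd : ∀ (b : Fin k) (q : ℕ), b < q → q < n → d q b = 0) :
    (Matrix.of fun a b => ∑ q ∈ Finset.range n, v a q * d q b).det =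
      (∏ b : Fin k, d b b) * (Matrix.of fun a b : Fin k => v a b).det := by
  have hmul : (Matrix.of fun a b => ∑ q ∈ Finset.range n, v a q * d q b) =
      (Matrix.of fun a q : Fin k => v a q) * Matrix.of fun q b : Fin k => d q b := by
    ext a b
    simp only [Matrix.mul_apply, Matrix.of_apply]
    rw [Fin.sum_univ_eq_sum_range (fun q => v a q * d q b) k]
    refine (Finset.sum_subset (Finset.range_subset_range.mpr hk) fun q hq hqk => ?_).symm
    rw [Finset.mem_range] at hq hqk
    rw [hd b q (by omega) hq, mul_zero]
  have hupper : (Matrix.of fun q b : Fin k => d q b).IsUpperTriangular := fun q b hbq =>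
    hd b q hbq (q.2.trans_le hk)
  rw [hmul, Matrix.det_mul, Matrix.det_of_isUpperTriangular hupper, mul_comm]
  simp only [Matrix.of_apply]

theorem det_sum_range_succ_mul (v : Fin k → ℕ → R) (d : ℕ → ℕ → R) :
    (Matrix.of fun a b : Fin k => ∑ q ∈ Finset.range ((b : ℕ) + 1), v a q * d q b).det =
      (∏ b : Fin k, d b b) * (Matrix.of fun a b : Fin k => v a b).det := by
  have hdiag : ∏ b : Fin k, d b b = ∏ b : Fin k, if (b : ℕ) ≤ b then d b b else 0 := by
    simp only [le_refl, if_true]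
  rw [hdiag, ← det_sum_range_mul_of_upper le_rfl v (fun q b => if q ≤ b then d q b else 0)
    fun b q hbq _ => if_neg hbq.not_ge]
  congr 1
  ext a b
  simp only [Matrix.of_apply, mul_ite, mul_zero]
  rw [← Finset.sum_filter]
  refine Finset.sum_congr ?_ fun _ _ => rfl
  ext q
  rw [Finset.mem_filter, Finset.mem_range, Finset.mem_range]
  omega

end Det

theorem prod_neg_one_mul_det_tailRow {k : ℕ} (hk : k ≤ n) (c : Fin n → Fin n → ℂˣ)
    (v : Fin k → ℕ → ℂ) :
    (∏ a : Fin k, (-1 : ℂ) ^ (a : ℕ)) * (Matrix.of fun a b : Fin k =>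
        ∑ q ∈ Finset.range n, v a q * tailRow c (1 + q) n (emb hk b)).det =
      (Matrix.of fun a N : Fin k => ∑ q ∈ Finset.range ((N : ℕ) + 1),
        v a q * ((-1) ^ q * upEntry n (coord c) (N - q) (1 + q))).det := by
  have hrow (b : Fin k) (q : ℕ) (hbq : b ≤ q) (hq : q < n) :
      tailRow c (1 + q) n (emb hk b) = if (b : ℕ) = q then 1 else 0 := by
    rw [emb, tailRow_inl_of_le c _ (by omega) le_rfl (by simp only [Fin.val_castLE]; omega)]
    exact if_congr (by simp only [Fin.val_castLE]; omega) rfl rfl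
  have hdiag (b : Fin k) : tailRow c (1 + b) n (emb hk b) = 1 := by
    rw [hrow b b le_rfl (b.2.trans_le hk), if_pos rfl]
  rw [det_sum_range_succ_mul v fun q N => (-1) ^ q * upEntry n (coord c) (N - q) (1 + q),
    det_sum_range_mul_of_upper hk v (fun q b => tailRow c (1 + q) n (emb hk b))
      fun b q hbq hq => by rw [hrow b q hbq.le hq, if_neg hbq.ne]]
  simp only [hdiag, Finset.prod_const_one, one_mul, Nat.sub_self, upEntry, mul_one]

theorem det_of_lowEntry_rows {𝕜 : Type*} [Field 𝕜] {q : ℕ → ℕ → 𝕜} (hq : ∀ i j, q i j ≠ 0)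
    (hq_zero : ∀ j, q 0 j = 1) {k : ℕ} (hk : 1 ≤ k) (p : ℕ) (M : Matrix (Fin k) (Fin k) 𝕜)
    (hM : ∀ a N : Fin k, (a : ℕ) + 1 < k → M a N = lowEntry q N p a) :
    M.det = M ⟨k - 1, by omega⟩ ⟨k - 1, by omega⟩ := by
  have hlower : M.IsLowerTriangular := fun a b hab => by
    have hab' : (a : ℕ) < b := hab
    rw [hM a b (by omega), lowEntry_of_lt _ _ hab']
  rw [Matrix.det_of_isLowerTriangular M hlower, Finset.prod_eq_single ⟨k - 1, by omega⟩]
  · intro a _ ha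
    have ha' : (a : ℕ) ≠ k - 1 := fun h => ha (Fin.ext h)
    rw [hM a a (by omega), lowEntry_self hq hq_zero]
  · simp

theorem prod_neg_one_mul_det_blockCol_rows {k : ℕ} (hk : 1 ≤ k) (hkn : k ≤ n)
    (c : Fin n → Fin n → ℂˣ) (v : Fin k → ℕ → ℂ)
    (hv : ∀ a : Fin k, (a : ℕ) + 1 < k → ∀ q, v a q = blockCol n (coord c) q 1 a) :
    (∏ a : Fin k, (-1 : ℂ) ^ (a : ℕ)) * (Matrix.of fun a b : Fin k =>
        ∑ q ∈ Finset.range n, v a q * tailRow c (1 + q) n (emb hkn b)).det =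
      ∑ q ∈ Finset.range (k - 1 + 1),
        v ⟨k - 1, by omega⟩ q * ((-1) ^ q * upEntry n (coord c) (k - 1 - q) (1 + q)) := by
  rw [prod_neg_one_mul_det_tailRow, det_of_lowEntry_rows (coord_ne_zero c) (coord_zero c) hk 1]
  · rfl
  · intro a N ha
    simp only [Matrix.of_apply, hv a ha]
    exact sum_blockCol_mul_upEntry _ _ _ (by omega)

/-- The rows `1̄, …, \overline{k-1}, \overline{s_k k}` of the minor of `g` that computes
`Δ_{w₀ s_k Λ_k, Λ_k}(g)`. -/
def minorRows {k : ℕ} (hk : 1 ≤ k) (hkn : k ≤ n) (a : Fin k) : J n :=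
  bar (reflPerm (node n k hk hkn) (emb hkn a))

section MinorRows

variable {k : ℕ} (hk : 1 ≤ k) (hkn : k ≤ n)

theorem minorRows_of_lt {a : Fin k} (ha : (a : ℕ) + 1 < k) :
    minorRows hk hkn a = Sum.inr (Fin.castLE hkn a) := by
  have hnode : (node n k hk hkn : ℕ) = k - 1 := rfl
  apply rank_injective
  rw [minorRows, rank_bar, rank_reflPerm, rank_emb, rank_inr, Fin.val_castLE,
    if_neg (by omega), if_neg (by omega), if_neg (by omega), if_neg (by omega)]

theorem minorRows_last {a : Fin k} (ha : (a : ℕ) + 1 = k) :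
    minorRows hk hkn a = bar (up (node n k hk hkn)) := by
  have hemb : emb hkn a = Sum.inl (node n k hk hkn) :=
    congrArg Sum.inl (Fin.ext (Nat.eq_sub_of_add_eq ha))
  rw [minorRows, hemb, reflPerm_inl]

theorem strictAnti_rank_minorRows : StrictAnti (rank ∘ minorRows hk hkn) := by
  intro b a hba
  have : (b : ℕ) < a := hba
  rw [Function.comp_apply, Function.comp_apply, minorRows_of_lt hk hkn (a := b) (by omega),
    rank_inr]
  by_cases ha : (a : ℕ) + 1 = k
  · rw [minorRows_last hk hkn ha, rank_bar, rank_up]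
    simp only [node, Fin.val_castLE]
    omega
  · rw [minorRows_of_lt hk hkn (a := a) (by omega), rank_inr]
    simp only [Fin.val_castLE]
    omega

theorem isIsotropic_minorRows : IsIsotropic (minorRows hk hkn) := by
  intro a b
  rw [minorRows, minorRows, bar_injective.ne_iff, ← reflPerm_bar, (Equiv.injective _).ne_iff]
  exact isIsotropic_emb hkn a b

theorem sum_wt_minorRows : ∑ a, wt (minorRows hk hkn a) =
    (w₀ n * s (node n k hk hkn) : Weight n ≃ₗ[ℤ] Weight n) (fundWeight (node n k hk hkn)) := by
  change _ = (w₀ n : Weight n ≃ₗ[ℤ] Weight n) (reflection _ _)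
  rw [w₀_apply, fundWeight_node_eq_sum, map_sum, ← Finset.sum_neg_distrib]
  refine Finset.sum_congr rfl fun a _ => ?_
  rw [minorRows, wt_bar, wt_reflPerm]

theorem generalizedMinor_w₀_s (c : Fin n → Fin n → ℂˣ) :
    generalizedMinor (fundWeight (node n k hk hkn))
        ((w₀ n * s (node n k hk hkn) : Weight n ≃ₗ[ℤ] Weight n) (fundWeight (node n k hk hkn)))
        (fundWeight (node n k hk hkn)) (Θ c) =
      (∏ a : Fin k, (-1 : ℂ) ^ (a : ℕ)) *
        ((mat (Θ c)).submatrix (minorRows hk hkn) (emb hkn)).det := by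
  have hanti := strictAnti_rank_minorRows hk hkn
  refine (generalizedMinor_fundWeight hk hkn ⟨w₀ n * s (node n k hk hkn), rfl⟩ ⟨1, rfl⟩
    hanti.injective.of_comp (emb_injective hkn) (isIsotropic_minorRows hk hkn)
    (isIsotropic_emb hkn) (sum_wt_minorRows hk hkn) (fundWeight_node_eq_sum hk hkn).symm
    (Θ_mem_joinedToTorus c)).trans ?_
  rw [inversionSign_emb, inversionSign_of_strictAnti ℂ hanti, one_mul]

end MinorRows

theorem mat_Θ_inr {k : ℕ} (hk : k ≤ n) (c : Fin n → Fin n → ℂˣ) (a : Fin n) (b : Fin k) :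
    mat (Θ c) (Sum.inr a) (emb hk b) = ∑ q ∈ Finset.range n,
      blockCol n (coord c) q 1 a * tailRow c (1 + q) n (emb hk b) := by
  rw [← tailMatrix_zero, emb, tailMatrix_inr_inl c (Nat.zero_add n)]

theorem generalizedMinor_of_lt {k : ℕ} (hk : 1 ≤ k) (hkn : k < n) (c : Fin n → Fin n → ℂˣ) :
    generalizedMinor (fundWeight (node n k hk hkn.le))
        ((w₀ n * s (node n k hk hkn.le) : Weight n ≃ₗ[ℤ] Weight n)
          (fundWeight (node n k hk hkn.le)))
        (fundWeight (node n k hk hkn.le)) (Θ c) =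
      1 / coord c 1 k + ∑ j ∈ Finset.Icc 1 (k - 1), coord c (k - j) j / coord c (k - j + 1) j := by
  let row : Fin k → Fin n := fun a => if (a : ℕ) + 1 < k then Fin.castLE hkn.le a else ⟨k, hkn⟩
  have hrow (a : Fin k) : minorRows hk hkn.le a = Sum.inr (row a) := by
    simp only [row]
    split_ifs with h
    · exact minorRows_of_lt hk hkn.le h
    · rw [minorRows_last hk hkn.le (by omega)]
      apply rank_injective
      rw [rank_bar, rank_up, rank_inr]
      simp only [node]
      omega
  have hminor : (mat (Θ c)).submatrix (minorRows hk hkn.le) (emb hkn.le) =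
      Matrix.of fun a b => ∑ q ∈ Finset.range n,
        blockCol n (coord c) q 1 (row a) * tailRow c (1 + q) n (emb hkn.le b) := by
    ext a b
    rw [Matrix.submatrix_apply, hrow, mat_Θ_inr, Matrix.of_apply]
  have hrow_last : (row ⟨k - 1, by omega⟩ : ℕ) = k - 1 + 1 := by
    simp only [row]
    rw [if_neg (by omega)]
    simp only
    omega
  rw [generalizedMinor_w₀_s, hminor, prod_neg_one_mul_det_blockCol_rows hk hkn.le c _
    fun a ha q => by simp only [row]; rw [if_pos ha]; rfl, hrow_last,
    sum_blockCol_mul_upEntry _ _ _ (by omega),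
    lowEntry_succ_self (coord_ne_zero c) (coord_zero c), Nat.add_sub_cancel' hk,
    ← Finset.Ico_succ_right_eq_Icc, Finset.sum_Ico_eq_sum_range]
  refine congrArg _ (Finset.sum_congr (by simp) fun j _ => ?_)
  rw [Nat.sub_add_eq]

theorem mat_Θ_inl_last (hn : 1 ≤ n) (c : Fin n → Fin n → ℂˣ) {g : ℕ → ℕ → ℂ}
    (hg : ∀ i b, g (i + 1) b = coord c i (n - (i - b)) / coord c (i + 1) (n - (i - b))) (t : J n) :
    mat (Θ c) (Sum.inl (node n n hn le_rfl)) t = ∑ q ∈ Finset.range n,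
      (-1) ^ q * increasingSum g n (q + 1) * tailRow c (1 + q) n t := by
  have hrel := sum_increasingSum_mul_tailRow c hg le_rfl t
  rw [Finset.sum_range_succ', increasingSum_zero, Nat.sub_self, pow_zero, one_mul, one_mul,
    tailRow_of_le c _ hn le_rfl, tailMatrix_zero] at hrel
  rw [eq_neg_of_add_eq_zero_right hrel, ← Finset.sum_neg_distrib]
  refine Finset.sum_congr rfl fun q _ => ?_
  rw [zero_add, add_comm q 1]
  ring

theorem generalizedMinor_last_eq_sum_increasingSum (hn : 1 ≤ n) (c : Fin n → Fin n → ℂˣ)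
    {g g' : ℕ → ℕ → ℂ}
    (hg : ∀ i b, g (i + 1) b = coord c (i + 1) (n - (b + 1)) / coord c i (n - (b + 1) + 1))
    (hg' : ∀ i b, g' (i + 1) b = coord c i (n - (i - b)) / coord c (i + 1) (n - (i - b))) :
    generalizedMinor (fundWeight (node n n hn le_rfl))
        ((w₀ n * s (node n n hn le_rfl) : Weight n ≃ₗ[ℤ] Weight n)
          (fundWeight (node n n hn le_rfl)))
        (fundWeight (node n n hn le_rfl)) (Θ c) =
      ∑ m ∈ Finset.range n, increasingSum g n m * increasingSum g' n (n - m) := by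
  let v : Fin n → ℕ → ℂ := fun a q => if (a : ℕ) + 1 < n then blockCol n (coord c) q 1 a
    else (-1) ^ q * increasingSum g' n (q + 1)
  have hminor : (mat (Θ c)).submatrix (minorRows hn le_rfl) (emb le_rfl) =
      Matrix.of fun a b => ∑ q ∈ Finset.range n, v a q * tailRow c (1 + q) n (emb le_rfl b) := by
    ext a b
    rw [Matrix.submatrix_apply, Matrix.of_apply]
    simp only [v]
    split_ifs with ha
    · rw [minorRows_of_lt hn le_rfl ha, mat_Θ_inr, Fin.val_castLE]
    · rw [minorRows_last hn le_rfl (by omega), up_of_le (Nat.sub_add_cancel hn).ge, bar_inr,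
        mat_Θ_inl_last hn c hg']
  rw [generalizedMinor_w₀_s, hminor, prod_neg_one_mul_det_blockCol_rows hn le_rfl c v
    fun a ha q => if_pos ha, Nat.sub_add_cancel hn, ← Finset.sum_range_reflect]
  refine Finset.sum_congr rfl fun m hm => ?_
  rw [Finset.mem_range] at hm
  have hv : v ⟨n - 1, by omega⟩ (n - 1 - m) =
      (-1) ^ (n - 1 - m) * increasingSum g' n (n - m) := by
    simp only [v]
    rw [if_neg (by omega), show n - 1 - m + 1 = n - m by omega]
  have hsign : (-1 : ℂ) ^ (n - 1 - m) * (-1) ^ (n - 1 - m) = 1 := by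
    rw [← mul_pow, neg_one_mul, neg_neg, one_pow]
  rw [hv, Nat.sub_sub_self (by omega), upEntry_eq_increasingSum hg (by omega), mul_mul_mul_comm,
    hsign, one_mul, mul_comm]

theorem generalizedMinor_last (hn : 1 ≤ n) (c : Fin n → Fin n → ℂˣ) :
    generalizedMinor (fundWeight (node n n hn le_rfl))
        ((w₀ n * s (node n n hn le_rfl) : Weight n ≃ₗ[ℤ] Weight n)
          (fundWeight (node n n hn le_rfl)))
        (fundWeight (node n n hn le_rfl)) (Θ c) =
      ∑ m ∈ Finset.range n,
        ∑ u ∈ increasing n m, ∑ l ∈ increasing n (n - m),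
          (∏ b : Fin m, monC c (u b) ((b : ℕ) + 1)) *
            ∏ a : Fin (n - m), monCbar c (l a) (l a - ((a : ℕ) + 1)) := by
  rw [generalizedMinor_last_eq_sum_increasingSum hn c (g := fun i b => monC c i (b + 1))
    (g' := fun i b => monCbar c i (i - (b + 1))) (fun _ _ => rfl) fun i b => by
      simp only [monCbar, Nat.add_sub_add_right, Nat.add_sub_cancel]]
  exact Finset.sum_congr rfl fun m _ => Finset.sum_mul_sum _ _ _ _

end TypeC

end

theorem mainTheorem2 (n : ℕ) (hn : 1 ≤ n) (c : Fin n → Fin n → ℂˣ) :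
    (∀ (k : ℕ) (hk : 1 ≤ k) (hkn : k < n),
      TypeC.generalizedMinor (TypeC.fundWeight (TypeC.node n k hk hkn.le))
          ((TypeC.w₀ n * TypeC.s (TypeC.node n k hk hkn.le) :
              TypeC.Weight n ≃ₗ[ℤ] TypeC.Weight n)
            (TypeC.fundWeight (TypeC.node n k hk hkn.le)))
          (TypeC.fundWeight (TypeC.node n k hk hkn.le)) (TypeC.Θ c) =
        1 / TypeC.coord c 1 k +
          ∑ j ∈ Finset.Icc 1 (k - 1), TypeC.coord c (k - j) j / TypeC.coord c (k - j + 1) j) ∧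
    TypeC.generalizedMinor (TypeC.fundWeight (TypeC.node n n hn le_rfl))
        ((TypeC.w₀ n * TypeC.s (TypeC.node n n hn le_rfl) :
            TypeC.Weight n ≃ₗ[ℤ] TypeC.Weight n)
          (TypeC.fundWeight (TypeC.node n n hn le_rfl)))
        (TypeC.fundWeight (TypeC.node n n hn le_rfl)) (TypeC.Θ c) =
      ∑ m ∈ Finset.range n,
        ∑ u ∈ TypeC.increasing n m, ∑ l ∈ TypeC.increasing n (n - m),
          (∏ b : Fin m, TypeC.monC c (u b) ((b : ℕ) + 1)) *
            ∏ a : Fin (n - m), TypeC.monCbar c (l a) (l a - ((a : ℕ) + 1)) :=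
  ⟨fun _ hk hkn => TypeC.generalizedMinor_of_lt hk hkn c, TypeC.generalizedMinor_last hn c⟩
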